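/- Let $d\ge 2$. A $(d-1)$-dimensional simplicial complex is *balanced* if its vertices are colored with $d$ colors so that no face contains two vertices of the same color. A *balanced connected sum* of two pure balanced $(d-1)$-dimensional complexes on disjoint vertex sets identifies the vertices of a facet of the first with those of a facet of the second by a color-preserving bijection and removes the resulting common face. A *balanced handle addition* to one pure balanced complex does the same with two disjoint facets $F,F'$ and a color-preserving bijection $\varphi:F\to F'$ such that, for each $v\in F$, the vertices $v$ and $\varphi(v)$ have no common neighbor. Let $\Delta_1,\Delta_2,\Delta_3$ be boundary complexes of $d$-dimensional cross-polytopes with vertex sets $\{x_i,y_i\}_{i=1}^d$, $\{y'_i,z_i\}_{i=1}^d$ and $\{z'_i,x'_i\}_{i=1}^d$ respectively, where the vertices with index $i$ are the two antipodal vertices of color $i$. Identifying $y_i$ with $y'_i$ for all $i$ gives a balanced connected sum $\Delta_1\#\Delta_2$; identifying $z_i$ with $z'_i$ for all $i$ gives a balanced connected sum $\widetilde\Delta=(\Delta_1\#\Delta_2)\#\Delta_3$; and identifying $x_i$ with $x'_i$ for all $i$ is a balanced handle addition to $\widetilde\Delta$. The resulting complex $BM_d$ is a balanced simplicial manifold of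 dimension $d-1$ with exactly $3d$ vertices (that is, its geometric realization is a topological $(d-1)$-manifold without boundary). Its geometric realization is homeomorphic to $\mathbb{S}^{d-2}\times\mathbb{S}^1$ if $d$ is odd, and to the nonorientable $\mathbb{S}^{d-2}$-bundle over $\mathbb{S}^1$ if $d$ is even, i.e. to the quotient of $\mathbb{S}^{d-2}\times[0,1]$ by $(x,0)\sim(r(x),1)$, where $r$ is the reflection of $\mathbb{S}^{d-2}\subset\mathbb{R}^{d-1}$ that changes the sign of the first coordinate. -/

import Mathlib

namespace BalancedManifold

/-! ### Simplicial complexes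

A complex is given by its nonempty faces, which are finite sets in an ambient type `V`; its vertices
are the `v : V` such that `{v}` is a face. -/

section Complexes

variable {V W : Type*}

/-- The vertex set of a complex. -/
def vertices (K : PreAbstractSimplicialComplex V) : Set V := {v | {v} ∈ K}

/-- A facet is a face that is maximal under inclusion. -/
def IsFacet (K : PreAbstractSimplicialComplex V) (s : Finset V) : Prop := Maximal (· ∈ K) s

/-- All facets have dimension `d - 1`, that is, `d` vertices. -/
def IsPure (d : ℕ) (K : PreAbstractSimplicialComplex V) : Prop := ∀ s, IsFacet K s → s.card = d

/-- Two distinct vertices are neighbors if they span an edge. -/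
def IsNeighbor [DecidableEq V] (K : PreAbstractSimplicialComplex V) (u v : V) : Prop :=
  u ≠ v ∧ ({u, v} : Finset V) ∈ K

/-- `K` has dimension `d - 1`, and `κ` is a coloring with `d` colors such that no face contains two
vertices of the same color. -/
structure IsBalanced (d : ℕ) (K : PreAbstractSimplicialComplex V) (κ : V → Fin d) : Prop where
  card_le : ∀ s ∈ K, s.card ≤ d
  exists_card_eq : ∃ s ∈ K, s.card = d
  injOn_color : ∀ s ∈ K, Set.InjOn κ s

/-- The complex obtained by removing all faces that contain `F`; if `F` is a facet, this removes
exactly the face `F`. -/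
def removeFace (K : PreAbstractSimplicialComplex V) (F : Finset V) :
    PreAbstractSimplicialComplex V where
  faces := {s | s ∈ K ∧ ¬ F ⊆ s}
  isRelLowerSet_faces := by
    rintro s ⟨hs, hF⟩
    exact ⟨(K.isRelLowerSet_faces hs).1, fun t hts ht =>
      ⟨(K.isRelLowerSet_faces hs).2 hts ht, fun h => hF (h.trans hts)⟩⟩

variable [DecidableEq V] [DecidableEq W]

/-- The connected sum of `Γ` and `Δ` along `φ : F → φ(F)`: in the disjoint union, every vertex `v`
of `F` is identified with the vertex `φ v` of `Δ` (which represents the identified pair), and the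
face on the identified vertices is removed. -/
def connectedSum (Γ : PreAbstractSimplicialComplex V) (Δ : PreAbstractSimplicialComplex W)
    (F : Finset V) (φ : V → W) : PreAbstractSimplicialComplex (V ⊕ W) :=
  removeFace
    (Γ.map (fun v => if v ∈ F then Sum.inr (φ v) else Sum.inl v) ⊔ Δ.map Sum.inr)
    (F.image (fun v => Sum.inr (φ v)))

/-- The conditions under which `connectedSum Γ Δ F φ` is a balanced connected sum of
`(d - 1)`-dimensional complexes colored by `κ` and `κ'`. -/
structure IsBalancedConnectedSum (d : ℕ) (Γ : PreAbstractSimplicialComplex V) (κ : V → Fin d)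
    (Δ : PreAbstractSimplicialComplex W) (κ' : W → Fin d) (F : Finset V) (φ : V → W) : Prop where
  balanced_left : IsBalanced d Γ κ
  balanced_right : IsBalanced d Δ κ'
  pure_left : IsPure d Γ
  pure_right : IsPure d Δ
  facet_left : IsFacet Γ F
  facet_right : IsFacet Δ (F.image φ)
  injOn : Set.InjOn φ F
  color : ∀ v ∈ F, κ' (φ v) = κ v

/-- The handle addition to `Δ` along `φ : F → φ(F)`: every vertex `v` of `F` is identified with the
vertex `φ v` (which represents the identified pair), and the face on the identified vertices is
removed. -/
def handleAddition (Δ : PreAbstractSimplicialComplex V) (F : Finset V) (φ : V → V) :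
    PreAbstractSimplicialComplex V :=
  removeFace (Δ.map (fun v => if v ∈ F then φ v else v)) (F.image φ)

/-- The conditions under which `handleAddition Δ F φ` is a balanced handle addition to the
`(d - 1)`-dimensional complex `Δ` colored by `κ`. -/
structure IsBalancedHandleAddition (d : ℕ) (Δ : PreAbstractSimplicialComplex V) (κ : V → Fin d)
    (F : Finset V) (φ : V → V) : Prop where
  balanced : IsBalanced d Δ κ
  pure : IsPure d Δ
  facet : IsFacet Δ F
  facet' : IsFacet Δ (F.image φ)
  disjoint : Disjoint F (F.image φ)
  injOn : Set.InjOn φ F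
  color : ∀ v ∈ F, κ (φ v) = κ v
  no_common_neighbor : ∀ v ∈ F, ∀ u, ¬ (IsNeighbor Δ v u ∧ IsNeighbor Δ (φ v) u)

/-- The geometric realization of a complex on a finite vertex set, in barycentric coordinates, with
the topology of a subspace of `ℝ^V`. -/
def realization [Fintype V] (K : PreAbstractSimplicialComplex V) : Set (V → ℝ) :=
  {w | w ∈ stdSimplex ℝ V ∧ ∃ s ∈ K, ∀ v, v ∉ s → w v = 0}

end Complexes

/-! ### Manifolds and sphere bundles over the circle -/

/-- `X` is a topological manifold (without boundary) of dimension `n`. -/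
structure IsTopologicalManifold (n : ℕ) (X : Type*) [TopologicalSpace X] : Prop where
  t2 : T2Space X
  secondCountable : SecondCountableTopology X
  locallyEuclidean : Nonempty (ChartedSpace (EuclideanSpace ℝ (Fin n)) X)

/-- `K` is a simplicial manifold of dimension `n`. -/
def IsSimplicialManifold {V : Type*} [Fintype V] (n : ℕ) (K : PreAbstractSimplicialComplex V) :
    Prop :=
  IsTopologicalManifold n (realization K)

/-- The unit sphere `S^n` in `ℝ^{n+1}`. -/
abbrev UnitSphere (n : ℕ) : Type := Metric.sphere (0 : EuclideanSpace ℝ (Fin (n + 1))) 1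

/-- The nonorientable `S^n`-bundle over `S^1`: the mapping torus of the reflection of `S^n` in the
first coordinate, that is, the quotient of `S^n × [0, 1]` that identifies `(x, 0)` with
`(r x, 1)`, where `r` changes the sign of the first coordinate. -/
abbrev NonorientableSphereBundle (n : ℕ) : Type :=
  Quot (fun p q : UnitSphere n × unitInterval =>
    p.2 = 0 ∧ q.2 = 1 ∧
      ∀ i : Fin (n + 1), q.1.1 i = if i = 0 then - p.1.1 i else p.1.1 i)

/-! ### The complex `BM d` -/

/-- The boundary complex of the `d`-dimensional cross-polytope, with the two vertices `(i, false)`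
and `(i, true)` of each color `i`: a nonempty set is a face if it contains at most one of the two
for each `i`. -/
def crossPolytope (d : ℕ) : PreAbstractSimplicialComplex (Fin d × Bool) where
  faces := {s | s.Nonempty ∧ ∀ i, ¬ ((i, false) ∈ s ∧ (i, true) ∈ s)}
  isRelLowerSet_faces := by
    rintro s ⟨hs, h⟩
    exact ⟨hs, fun t hts ht => ⟨ht, fun i hi => h i ⟨hts hi.1, hts hi.2⟩⟩⟩

/-- The vertices of the sum of two cross-polytopes. -/
abbrev Vert₂ (d : ℕ) : Type := (Fin d × Bool) ⊕ (Fin d × Bool)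

/-- The vertices of the sum of three cross-polytopes. They are named
`x i = inl (inl (i, false))`, `y i = inl (inl (i, true))` (first cross-polytope),
`y' i = inl (inr (i, false))`, `z i = inl (inr (i, true))` (second cross-polytope),
`z' i = inr (i, false)`, `x' i = inr (i, true)` (third cross-polytope). -/
abbrev Vert₃ (d : ℕ) : Type := Vert₂ d ⊕ (Fin d × Bool)

/-- The vertices with index `i` have color `i`. -/
def color₁ (d : ℕ) : Fin d × Bool → Fin d := Prod.fst

/-- The vertices with index `i` have color `i`. -/
def color₂ (d : ℕ) : Vert₂ d → Fin d := Sum.elim (color₁ d) (color₁ d)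

/-- The vertices with index `i` have color `i`. -/
def color₃ (d : ℕ) : Vert₃ d → Fin d := Sum.elim (color₂ d) (color₁ d)

/-- The facet `{y 1, …, y d}` of the first cross-polytope. -/
def facetY (d : ℕ) : Finset (Fin d × Bool) := Finset.univ.image (fun i => (i, true))

/-- The identification of `y i` with `y' i`. -/
def glueY (d : ℕ) : Fin d × Bool → Fin d × Bool := fun v => (color₁ d v, false)

/-- The connected sum of the first two cross-polytopes, with `y i` identified with `y' i`. -/
def sum₂ (d : ℕ) : PreAbstractSimplicialComplex (Vert₂ d) :=
  connectedSum (crossPolytope d) (crossPolytope d) (facetY d) (glueY d)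

/-- The facet `{z 1, …, z d}` of the sum of the first two cross-polytopes. -/
def facetZ (d : ℕ) : Finset (Vert₂ d) := Finset.univ.image (fun i => Sum.inr (i, true))

/-- The identification of `z i` with `z' i`. -/
def glueZ (d : ℕ) : Vert₂ d → Fin d × Bool := fun v => (color₂ d v, false)

/-- The connected sum of the three cross-polytopes, with `z i` identified with `z' i`. -/
def sum₃ (d : ℕ) : PreAbstractSimplicialComplex (Vert₃ d) :=
  connectedSum (sum₂ d) (crossPolytope d) (facetZ d) (glueZ d)

/-- The facet `{x 1, …, x d}` of the sum of the three cross-polytopes. -/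
def facetX (d : ℕ) : Finset (Vert₃ d) :=
  Finset.univ.image (fun i => Sum.inl (Sum.inl (i, false)))

/-- The identification of `x i` with `x' i`. -/
def glueX (d : ℕ) : Vert₃ d → Vert₃ d := fun v => Sum.inr (color₃ d v, true)

/-- The complex `BM d`: a handle is added by identifying `x i` with `x' i`. -/
def BM (d : ℕ) : PreAbstractSimplicialComplex (Vert₃ d) :=
  handleAddition (sum₃ d) (facetX d) (glueX d)

end BalancedManifold

open BalancedManifold

/-! The vertices of `BM d` form three cyclically ordered layers, each with one vertex of every
color. By `mem_BM_iff_vtx`, a nonempty set is a face exactly if its colors are distinct, it lies in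
two consecutive layers and it contains no whole layer. The faces in layers `k` and `k + 1` form a
cross-polytope boundary with two opposite facets removed, which is a closed cylinder over the sphere
of dimension `d - 2`.

Let `d = n + 2`. Describe a point of the `k`-th cylinder by a signed vector `u` in `ℝ^{n+2}` of
`ℓ¹`-norm `1`: positive entries are weights in layer `k + 1`, negative entries are weights in layer
`k`. The removed facets say that the entries of `u` are neither all positive nor all negative.
Modulo constant vectors, `u` is a nonzero vector of `ℝ^{n+1}`; its direction is a point `x` of
`S^n`, and the constant subtracted is a level between the largest and the smallest entry, recorded
by `s ∈ [0, 1]`. This parametrizes the cylinder (`exists_cylinderPoint_eq`,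
`eq_of_cylinderPoint_eq_self`).

At `s = 1` only layer `k + 1` carries weight. The next cylinder counts this layer with the opposite
sign, so its beginning is glued to this end by `x ↦ -x` (`cylinderPoint_one_eq`,
`cylinderMap_eq_iff`). Three antipodal gluings compose to one, and the realization is the mapping
torus of the antipodal map of `S^n`. Up to isotopy, this map is the identity if `n` is odd and the
reflection in one coordinate if `n` is even: rotate disjoint pairs of coordinates by the angle `π`.
This gives the homeomorphism type (`exists_homeomorph_of_isotopy`). Charts come from the open
cylinder over `(0, 1)`, into which the cyclic symmetry of the layers moves every point. -/

namespace BalancedManifold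

/-! ### Explicit descriptions of the faces of the connected sums and of `BM d` -/

section Faces

variable {V W : Type*} {d : ℕ}

theorem injOn_image_of_color [DecidableEq W] {κ : V → Fin d} {κ' : W → Fin d} {h : V → W}
    {t : Finset V} (hc : ∀ v ∈ t, κ' (h v) = κ v) (ht : Set.InjOn κ t) :
    Set.InjOn κ' (t.image h : Finset W) := by
  intro a ha b hb hab
  simp only [Finset.coe_image, Set.mem_image, Finset.mem_coe] at ha hb
  obtain ⟨a, ha, rfl⟩ := ha
  obtain ⟨b, hb, rfl⟩ := hb
  rw [hc a ha, hc b hb] at hab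
  rw [ht ha hb hab]

theorem mem_map_iff [DecidableEq W] {K : PreAbstractSimplicialComplex V} {h : V → W}
    {s : Finset W} : s ∈ K.map h ↔ ∃ t ∈ K, t.image h = s := Iff.rfl

theorem mem_removeFace_iff {K : PreAbstractSimplicialComplex V} {F s : Finset V} :
    s ∈ removeFace K F ↔ s ∈ K ∧ ¬ F ⊆ s := Iff.rfl

theorem mem_sup_iff {K L : PreAbstractSimplicialComplex V} {s : Finset V} :
    s ∈ K ⊔ L ↔ s ∈ K ∨ s ∈ L := Iff.rfl

theorem card_le_of_injOn_color {κ : V → Fin d} {s : Finset V} (hs : Set.InjOn κ s) :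
    s.card ≤ d := by
  classical
  rw [← Finset.card_image_of_injOn hs]
  simpa using Finset.card_le_univ (s.image κ)

theorem exists_color_not_mem {κ : V → Fin d} {s : Finset V} (hs : s.card < d) :
    ∃ i, ∀ v ∈ s, κ v ≠ i := by
  classical
  by_contra! h
  have h1 : s.image κ = Finset.univ := by
    ext i
    simpa using h i
  have h2 := Finset.card_image_le (s := s) (f := κ)
  rw [h1] at h2
  simp at h2
  omega

theorem injOn_insert_of_color [DecidableEq V] {κ : V → Fin d} {s : Finset V} {a : V}
    (hs : Set.InjOn κ s) (ha : ∀ v ∈ s, κ v ≠ κ a) :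
    Set.InjOn κ (insert a s : Finset V) := by
  intro u hu v hv huv
  simp only [Finset.coe_insert, Set.mem_insert_iff, Finset.mem_coe] at hu hv
  rcases hu with rfl | hu <;> rcases hv with rfl | hv
  · rfl
  · exact absurd huv.symm (ha v hv)
  · exact absurd huv (ha u hu)
  · exact hs hu hv huv

theorem isFacet_of_card {K : PreAbstractSimplicialComplex V} {s : Finset V} {κ : V → Fin d}
    (hK : ∀ s ∈ K, Set.InjOn κ s) (hs : s ∈ K) (hc : s.card = d) : IsFacet K s := by
  refine ⟨hs, fun t ht hst => ?_⟩
  have := card_le_of_injOn_color (hK t ht)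
  exact (Finset.eq_of_subset_of_card_le hst (by omega)).ge

/-- A complex with color-injective faces is pure if every face missing a color extends by a vertex
of that color. -/
theorem isPure_of_extend [DecidableEq V] {K : PreAbstractSimplicialComplex V} {κ : V → Fin d}
    (hK : ∀ s ∈ K, Set.InjOn κ s)
    (he : ∀ s ∈ K, ∀ i, (∀ v ∈ s, κ v ≠ i) → ∃ a, κ a = i ∧ insert a s ∈ K) : IsPure d K := by
  intro s hs
  by_contra hne
  have hlt : s.card < d := lt_of_le_of_ne (card_le_of_injOn_color (hK s hs.1)) hne
  obtain ⟨i, hi⟩ := exists_color_not_mem (κ := κ) hlt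
  obtain ⟨a, ha, has⟩ := he s hs.1 i hi
  have : a ∈ s := hs.2 has (Finset.subset_insert a s) (Finset.mem_insert_self a s)
  exact hi a this ha

theorem isBalanced_of_mem {K : PreAbstractSimplicialComplex V} {κ : V → Fin d} {F : Finset V}
    (hK : ∀ s ∈ K, Set.InjOn κ s) (hF : F ∈ K) (hc : F.card = d) : IsBalanced d K κ :=
  ⟨fun s hs => card_le_of_injOn_color (hK s hs), ⟨F, hF, hc⟩, hK⟩

theorem mem_crossPolytope_iff {s : Finset (Fin d × Bool)} :
    s ∈ crossPolytope d ↔ s.Nonempty ∧ Set.InjOn (color₁ d) s := by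
  refine and_congr_right fun _ => ⟨?_, ?_⟩
  · rintro h ⟨i, a⟩ ha ⟨j, b⟩ hb hab
    obtain rfl : i = j := hab
    have := h i
    cases a <;> cases b <;> simp_all
  · rintro h i ⟨h1, h2⟩
    simpa using h h1 h2 rfl

/-- The label of a vertex of the sum of two cross-polytopes: `0` for `x`, `1` for `y`, `2` for `z`,
and `4` for the vertices that are not used. -/
def label₂ : Vert₂ d → ℕ
  | Sum.inl (_, false) => 0
  | Sum.inl (_, true) => 4
  | Sum.inr (_, false) => 1
  | Sum.inr (_, true) => 2

/-- The label of a vertex of the sum of three cross-polytopes: `0` for `x`, `1` for `y`, `2` for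
`z`, `3` for `x'`, and larger for the vertices that are not used. -/
def label₃ : Vert₃ d → ℕ
  | Sum.inl (Sum.inl (_, false)) => 0
  | Sum.inl (Sum.inl (_, true)) => 4
  | Sum.inl (Sum.inr (_, false)) => 1
  | Sum.inl (Sum.inr (_, true)) => 5
  | Sum.inr (_, false) => 2
  | Sum.inr (_, true) => 3

/-- All vertices of `s` have label `a` or `b`. -/
def HasLabels (l : V → ℕ) (a b : ℕ) (s : Finset V) : Prop := ∀ v ∈ s, l v = a ∨ l v = b

theorem HasLabels.insert [DecidableEq V] {l : V → ℕ} {a b : ℕ} {s : Finset V} {v : V}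
    (hs : HasLabels l a b s) (hv : l v = a ∨ l v = b) : HasLabels l a b (insert v s) := by
  intro u hu
  rcases Finset.mem_insert.1 hu with rfl | hu
  exacts [hv, hs u hu]

theorem HasLabels.image [DecidableEq W] {l : V → ℕ} {l' : W → ℕ} {a b a' b' : ℕ} {f : V → W}
    {s : Finset V} (hs : HasLabels l a b s)
    (hf : ∀ v, l v = a ∨ l v = b → l' (f v) = a' ∨ l' (f v) = b') :
    HasLabels l' a' b' (s.image f) := by
  intro w hw
  obtain ⟨v, hv, rfl⟩ := Finset.mem_image.1 hw
  exact hf v (hs v hv)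

/-- Used to lift faces through a gluing map `h`, which need not be injective: on vertices with two
given labels, it has a section `h'`. -/
theorem HasLabels.image_image_eq_self [DecidableEq V] [DecidableEq W] {l : W → ℕ} {a b : ℕ}
    {s : Finset W} (hs : HasLabels l a b s) {h : V → W} {h' : W → V}
    (hh : ∀ w, l w = a ∨ l w = b → h (h' w) = w) : (s.image h').image h = s := by
  rw [Finset.image_image]
  conv_rhs => rw [← Finset.image_id (s := s)]
  exact Finset.image_congr fun w hw => hh w (hs w hw)

theorem notMem_image [DecidableEq W] {f : V → W} {s : Finset V} {w : W} {v : V} (hv : v ∉ s)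
    (hf : ∀ u, f u = w → u = v) : w ∉ s.image f := by
  intro h
  obtain ⟨u, hu, he⟩ := Finset.mem_image.1 h
  exact hv (hf u he ▸ hu)

theorem color₂_glue (v : Fin d × Bool) : color₂ d
    (if v ∈ facetY d then Sum.inr (glueY d v) else Sum.inl v) = color₁ d v := by
  split_ifs <;> rfl

theorem color₃_glue (v : Vert₂ d) : color₃ d
    (if v ∈ facetZ d then Sum.inr (glueZ d v) else Sum.inl v) = color₂ d v := by
  split_ifs <;> rfl

theorem color₃_glue_handle (v : Vert₃ d) : color₃ d
    (if v ∈ facetX d then glueX d v else v) = color₃ d v := by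
  split_ifs <;> rfl

/-- Gluing preserves colors, and the labels record the cross-polytope from which a face comes.
Conversely, on each pair of labels the gluing has an explicit section, which recovers a face of the
cross-polytope. -/
theorem mem_sum₂_iff {s : Finset (Vert₂ d)} :
    s ∈ sum₂ d ↔ s.Nonempty ∧ Set.InjOn (color₂ d) s ∧
      (HasLabels label₂ 0 1 s ∨ HasLabels label₂ 1 2 s) ∧ ∃ i, Sum.inr (i, false) ∉ s := by
  have hF : (facetY d).image (fun v => (Sum.inr (glueY d v) : Vert₂ d)) ⊆ s ↔
      ∀ i, Sum.inr (i, false) ∈ s := by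
    simp [facetY, glueY, color₁, Finset.subset_iff]
  rw [sum₂, connectedSum, mem_removeFace_iff, hF, mem_sup_iff, mem_map_iff, mem_map_iff, not_forall]
  constructor
  · rintro ⟨⟨t, ht, rfl⟩ | ⟨t, ht, rfl⟩, hi⟩ <;> rw [mem_crossPolytope_iff] at ht
    · refine ⟨ht.1.image _, injOn_image_of_color (fun v _ => color₂_glue v) ht.2, Or.inl ?_, hi⟩
      intro v hv
      obtain ⟨⟨i, _ | _⟩, -, rfl⟩ := Finset.mem_image.1 hv <;>
        simp [facetY, glueY, color₁, label₂]
    · refine ⟨ht.1.image _, injOn_image_of_color (fun _ _ => rfl) ht.2, Or.inr ?_, hi⟩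
      intro v hv
      obtain ⟨⟨i, _ | _⟩, -, rfl⟩ := Finset.mem_image.1 hv <;> simp [label₂]
  · rintro ⟨hne, hinj, hl | hl, hi⟩ <;> refine ⟨?_, hi⟩
    · refine Or.inl ⟨s.image (Sum.elim (fun v => (v.1, false)) (fun v => (v.1, true))), ?_, ?_⟩
      · refine mem_crossPolytope_iff.2 ⟨hne.image _, injOn_image_of_color ?_ hinj⟩
        rintro (v | v) - <;> rfl
      · refine hl.image_image_eq_self ?_
        rintro (⟨i, _ | _⟩ | ⟨i, _ | _⟩) <;> simp [label₂, facetY, glueY, color₁]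
    · refine Or.inr ⟨s.image (Sum.elim id id), ?_, ?_⟩
      · refine mem_crossPolytope_iff.2 ⟨hne.image _, injOn_image_of_color ?_ hinj⟩
        rintro (v | v) - <;> rfl
      · refine hl.image_image_eq_self ?_
        rintro (⟨i, _ | _⟩ | ⟨i, _ | _⟩) <;> simp [label₂]

theorem mem_sum₃_iff {s : Finset (Vert₃ d)} :
    s ∈ sum₃ d ↔ s.Nonempty ∧ Set.InjOn (color₃ d) s ∧
      (HasLabels label₃ 0 1 s ∨ HasLabels label₃ 1 2 s ∨ HasLabels label₃ 2 3 s) ∧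
      (∃ i, Sum.inl (Sum.inr (i, false)) ∉ s) ∧ ∃ i, Sum.inr (i, false) ∉ s := by
  have hF : (facetZ d).image (fun v => (Sum.inr (glueZ d v) : Vert₃ d)) ⊆ s ↔
      ∀ i, Sum.inr (i, false) ∈ s := by
    simp [facetZ, glueZ, color₂, color₁, Finset.subset_iff]
  rw [sum₃, connectedSum, mem_removeFace_iff, hF, mem_sup_iff, mem_map_iff, mem_map_iff, not_forall]
  constructor
  · rintro ⟨⟨t, ht, rfl⟩ | ⟨t, ht, rfl⟩, hi⟩
    · rw [mem_sum₂_iff] at ht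
      obtain ⟨hne, hinj, hl, j, hj⟩ := ht
      refine ⟨hne.image _, injOn_image_of_color (fun v _ => color₃_glue v) hinj, ?_,
        ⟨j, notMem_image hj ?_⟩, hi⟩
      · rw [← or_assoc]
        refine Or.inl (hl.imp (fun hl => hl.image ?_) (fun hl => hl.image ?_)) <;>
          rintro (⟨i, _ | _⟩ | ⟨i, _ | _⟩) <;> simp [facetZ, glueZ, label₃, label₂]
      · rintro (⟨i, _ | _⟩ | ⟨i, _ | _⟩) <;> simp [facetZ]
    · rw [mem_crossPolytope_iff] at ht
      obtain ⟨j, hj⟩ := hi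
      refine ⟨ht.1.image _, injOn_image_of_color (fun _ _ => rfl) ht.2, Or.inr (Or.inr ?_),
        ⟨j, by simp⟩, j, hj⟩
      intro v hv
      obtain ⟨⟨i, _ | _⟩, -, rfl⟩ := Finset.mem_image.1 hv <;> simp [label₃]
  · rintro ⟨hne, hinj, hl, ⟨j, hj⟩, hi⟩
    refine ⟨?_, hi⟩
    rw [← or_assoc] at hl
    refine hl.imp (fun hl => ?_) (fun hl => ?_)
    · refine ⟨s.image (Sum.elim id (fun v => Sum.inr (v.1, true))), ?_, ?_⟩
      · refine mem_sum₂_iff.2 ⟨hne.image _, injOn_image_of_color ?_ hinj, ?_, j,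
          notMem_image hj ?_⟩
        · rintro (v | v) - <;> rfl
        · refine hl.imp (fun hl => hl.image ?_) (fun hl => hl.image ?_) <;>
            rintro ((⟨i, _ | _⟩ | ⟨i, _ | _⟩) | ⟨i, _ | _⟩) <;> simp [label₃, label₂]
        · rintro ((⟨i, _ | _⟩ | ⟨i, _ | _⟩) | ⟨i, _ | _⟩) <;> simp
      · rcases hl with hl | hl <;> refine hl.image_image_eq_self ?_ <;>
          rintro ((⟨i, _ | _⟩ | ⟨i, _ | _⟩) | ⟨i, _ | _⟩) <;>
          simp [label₃, facetZ, glueZ, color₂, color₁]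
    · refine ⟨s.image (Sum.elim (fun v => (color₂ d v, false)) id), ?_, ?_⟩
      · refine mem_crossPolytope_iff.2 ⟨hne.image _, injOn_image_of_color ?_ hinj⟩
        rintro (v | v) - <;> rfl
      · refine hl.image_image_eq_self ?_
        rintro ((⟨i, _ | _⟩ | ⟨i, _ | _⟩) | ⟨i, _ | _⟩) <;> simp [label₃]

theorem mem_BM_iff {s : Finset (Vert₃ d)} :
    s ∈ BM d ↔ s.Nonempty ∧ Set.InjOn (color₃ d) s ∧
      (HasLabels label₃ 3 1 s ∨ HasLabels label₃ 1 2 s ∨ HasLabels label₃ 2 3 s) ∧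
      (∃ i, Sum.inl (Sum.inr (i, false)) ∉ s) ∧ (∃ i, Sum.inr (i, false) ∉ s) ∧
      ∃ i, Sum.inr (i, true) ∉ s := by
  have hF : (facetX d).image (glueX d) ⊆ s ↔ ∀ i, Sum.inr (i, true) ∈ s := by
    simp [facetX, glueX, color₃, color₂, color₁, Finset.subset_iff]
  rw [BM, handleAddition, mem_removeFace_iff, hF, mem_map_iff, not_forall]
  constructor
  · rintro ⟨⟨t, ht, rfl⟩, hi⟩
    rw [mem_sum₃_iff] at ht
    obtain ⟨hne, hinj, hl, ⟨j, hj⟩, k, hk⟩ := ht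
    refine ⟨hne.image _, injOn_image_of_color (fun v _ => color₃_glue_handle v) hinj, ?_,
      ⟨j, notMem_image hj ?_⟩, ⟨k, notMem_image hk ?_⟩, hi⟩
    · refine hl.imp (fun hl => hl.image ?_)
        (Or.imp (fun hl => hl.image ?_) (fun hl => hl.image ?_)) <;>
        rintro ((⟨i, _ | _⟩ | ⟨i, _ | _⟩) | ⟨i, _ | _⟩) <;> simp [facetX, glueX, label₃]
    all_goals
      rintro ((⟨i, _ | _⟩ | ⟨i, _ | _⟩) | ⟨i, _ | _⟩) <;> simp [facetX, glueX]
  · rintro ⟨hne, hinj, hl, ⟨j, hj⟩, ⟨k, hk⟩, hi⟩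
    refine ⟨?_, hi⟩
    rcases hl with hl | hl
    -- The first piece was attached through the `x i`, so the glued vertices are pulled back to
    -- these. Faces of the other two pieces are untouched by the gluing and lift to themselves.
    · refine ⟨s.image (fun v => if label₃ v = 3 then Sum.inl (Sum.inl (color₃ d v, false)) else v),
        ?_, ?_⟩
      · refine mem_sum₃_iff.2 ⟨hne.image _, injOn_image_of_color ?_ hinj, Or.inl (hl.image ?_),
          ⟨j, notMem_image hj ?_⟩, k, notMem_image hk ?_⟩
        · intro v _
          split_ifs <;> rfl
        all_goals
          rintro ((⟨i, _ | _⟩ | ⟨i, _ | _⟩) | ⟨i, _ | _⟩) <;> simp [label₃]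
      · refine hl.image_image_eq_self ?_
        rintro ((⟨i, _ | _⟩ | ⟨i, _ | _⟩) | ⟨i, _ | _⟩) <;>
          simp [label₃, facetX, glueX, color₃, color₂, color₁]
    · refine ⟨s, mem_sum₃_iff.2 ⟨hne, hinj, Or.inr hl, ⟨j, hj⟩, k, hk⟩, ?_⟩
      rw [← Finset.image_id (s := s), Finset.image_image]
      rcases hl with hl | hl <;> refine Finset.image_congr fun v hv => ?_ <;> have h := hl v hv <;>
        clear hv <;> revert v <;>
        rintro ((⟨i, _ | _⟩ | ⟨i, _ | _⟩) | ⟨i, _ | _⟩) <;> simp [label₃, facetX]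

end Faces

/-! ### Balance, purity, the handle condition and the vertex count -/

section Constructions

variable {V : Type*} {d : ℕ}

theorem card_image_section [DecidableEq V] {κ : V → Fin d} {g : Fin d → V} (hg : ∀ i, κ (g i) = i) :
    (Finset.univ.image g).card = d := by
  rw [Finset.card_image_of_injective _ (Function.LeftInverse.injective hg), Finset.card_fin]

theorem injOn_image_section [DecidableEq V] {κ : V → Fin d} {g : Fin d → V}
    (hg : ∀ i, κ (g i) = i) : Set.InjOn κ (Finset.univ.image g : Finset V) :=
  injOn_image_of_color (κ := id) (fun i _ => hg i) (Set.injOn_id _)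

theorem image_section_nonempty [DecidableEq V] (hd : 2 ≤ d) (g : Fin d → V) :
    (Finset.univ.image g).Nonempty :=
  Finset.Nonempty.image ⟨⟨0, by omega⟩, Finset.mem_univ _⟩ g

theorem exists_fin_ne (hd : 2 ≤ d) (i : Fin d) : ∃ j, j ≠ i := by
  have := Fin.nontrivial_iff_two_le.2 hd
  exact exists_ne i

theorem image_section_mem_crossPolytope (hd : 2 ≤ d) (b : Bool) :
    Finset.univ.image (fun i : Fin d => (i, b)) ∈ crossPolytope d :=
  mem_crossPolytope_iff.2 ⟨image_section_nonempty hd _, injOn_image_section fun _ => rfl⟩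

theorem injOn_color_crossPolytope : ∀ s ∈ crossPolytope d, Set.InjOn (color₁ d) s :=
  fun _ hs => (mem_crossPolytope_iff.1 hs).2

theorem isBalanced_crossPolytope (hd : 2 ≤ d) : IsBalanced d (crossPolytope d) (color₁ d) :=
  isBalanced_of_mem injOn_color_crossPolytope (image_section_mem_crossPolytope hd true)
    (card_image_section (κ := color₁ d) fun _ => rfl)

theorem isPure_crossPolytope : IsPure d (crossPolytope d) := by
  refine isPure_of_extend injOn_color_crossPolytope fun s hs i hi => ⟨(i, true), rfl, ?_⟩
  exact mem_crossPolytope_iff.2 ⟨Finset.insert_nonempty _ _,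
    injOn_insert_of_color (injOn_color_crossPolytope s hs) hi⟩

theorem isFacet_crossPolytope (hd : 2 ≤ d) (b : Bool) :
    IsFacet (crossPolytope d) (Finset.univ.image (fun i : Fin d => (i, b))) :=
  isFacet_of_card injOn_color_crossPolytope (image_section_mem_crossPolytope hd b)
    (card_image_section (κ := color₁ d) fun _ => rfl)

theorem isBalancedConnectedSum_crossPolytope (hd : 2 ≤ d) :
    IsBalancedConnectedSum d (crossPolytope d) (color₁ d) (crossPolytope d) (color₁ d)
      (facetY d) (glueY d) where
  balanced_left := isBalanced_crossPolytope hd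
  balanced_right := isBalanced_crossPolytope hd
  pure_left := isPure_crossPolytope
  pure_right := isPure_crossPolytope
  facet_left := isFacet_crossPolytope hd true
  facet_right := by
    rw [facetY, Finset.image_image]
    exact isFacet_crossPolytope hd false
  injOn := by
    intro u hu v hv huv
    simp only [facetY, Finset.coe_image, Set.mem_image] at hu hv
    obtain ⟨i, -, rfl⟩ := hu
    obtain ⟨j, -, rfl⟩ := hv
    simpa [glueY, color₁] using huv
  color := fun _ _ => rfl

theorem injOn_color_sum₂ : ∀ s ∈ sum₂ d, Set.InjOn (color₂ d) s :=
  fun _ hs => (mem_sum₂_iff.1 hs).2.1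

theorem facetZ_mem (hd : 2 ≤ d) : facetZ d ∈ sum₂ d := by
  refine mem_sum₂_iff.2 ⟨image_section_nonempty hd _, injOn_image_section fun _ => rfl, Or.inr ?_,
    ⟨0, by omega⟩, by simp [facetZ]⟩
  intro v hv
  obtain ⟨i, -, rfl⟩ := Finset.mem_image.1 hv
  exact Or.inr rfl

theorem card_facetZ : (facetZ d).card = d := card_image_section (κ := color₂ d) fun _ => rfl

/-- A missing color is filled by an `x` or a `z`, never by a `y`, so the removed face cannot be
completed. -/
theorem isPure_sum₂ : IsPure d (sum₂ d) := by
  refine isPure_of_extend injOn_color_sum₂ fun s hs i hi => ?_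
  obtain ⟨-, hinj, hl | hl, j, hj⟩ := mem_sum₂_iff.1 hs
  · exact ⟨Sum.inl (i, false), rfl, mem_sum₂_iff.2 ⟨Finset.insert_nonempty _ _,
      injOn_insert_of_color hinj hi, Or.inl (hl.insert (Or.inl rfl)), j, by simpa using hj⟩⟩
  · exact ⟨Sum.inr (i, true), rfl, mem_sum₂_iff.2 ⟨Finset.insert_nonempty _ _,
      injOn_insert_of_color hinj hi, Or.inr (hl.insert (Or.inr rfl)), j, by simpa using hj⟩⟩

theorem isBalancedConnectedSum_sum₂ (hd : 2 ≤ d) :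
    IsBalancedConnectedSum d (sum₂ d) (color₂ d) (crossPolytope d) (color₁ d)
      (facetZ d) (glueZ d) where
  balanced_left := isBalanced_of_mem injOn_color_sum₂ (facetZ_mem hd) card_facetZ
  balanced_right := isBalanced_crossPolytope hd
  pure_left := isPure_sum₂
  pure_right := isPure_crossPolytope
  facet_left := isFacet_of_card injOn_color_sum₂ (facetZ_mem hd) card_facetZ
  facet_right := by
    rw [facetZ, Finset.image_image]
    exact isFacet_crossPolytope hd false
  injOn := by
    intro u hu v hv huv
    simp only [facetZ, Finset.coe_image, Set.mem_image] at hu hv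
    obtain ⟨i, -, rfl⟩ := hu
    obtain ⟨j, -, rfl⟩ := hv
    simpa [glueZ, color₂, color₁] using huv
  color := fun _ _ => rfl

theorem injOn_color_sum₃ : ∀ s ∈ sum₃ d, Set.InjOn (color₃ d) s :=
  fun _ hs => (mem_sum₃_iff.1 hs).2.1

theorem facetX_mem (hd : 2 ≤ d) : facetX d ∈ sum₃ d := by
  refine mem_sum₃_iff.2 ⟨image_section_nonempty hd _, injOn_image_section fun _ => rfl, Or.inl ?_,
    ⟨⟨0, by omega⟩, by simp [facetX]⟩, ⟨0, by omega⟩, by simp [facetX]⟩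
  intro v hv
  obtain ⟨i, -, rfl⟩ := Finset.mem_image.1 hv
  exact Or.inl rfl

theorem image_glueX_facetX :
    (facetX d).image (glueX d) = Finset.univ.image (fun i => Sum.inr (i, true)) := by
  rw [facetX, Finset.image_image]
  rfl

theorem image_glueX_mem (hd : 2 ≤ d) : (facetX d).image (glueX d) ∈ sum₃ d := by
  rw [image_glueX_facetX]
  refine mem_sum₃_iff.2 ⟨image_section_nonempty hd _, injOn_image_section fun _ => rfl,
    Or.inr (Or.inr ?_), ⟨⟨0, by omega⟩, by simp⟩, ⟨0, by omega⟩, by simp⟩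
  intro v hv
  obtain ⟨i, -, rfl⟩ := Finset.mem_image.1 hv
  exact Or.inr rfl

theorem card_facetX : (facetX d).card = d := card_image_section (κ := color₃ d) fun _ => rfl

theorem isPure_sum₃ (hd : 2 ≤ d) : IsPure d (sum₃ d) := by
  refine isPure_of_extend injOn_color_sum₃ fun s hs i hi => ?_
  obtain ⟨-, hinj, hl | hl | hl, ⟨j, hj⟩, k, hk⟩ := mem_sum₃_iff.1 hs
  · exact ⟨Sum.inl (Sum.inl (i, false)), rfl, mem_sum₃_iff.2 ⟨Finset.insert_nonempty _ _,
      injOn_insert_of_color hinj hi, Or.inl (hl.insert (Or.inl rfl)), ⟨j, by simpa using hj⟩,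
      k, by simpa using hk⟩⟩
  -- In the middle piece both end facets are removed. If adding `y i` would complete the facet of
  -- all `y`, then the other colors are already taken by `y`, so some `z m` with `m ≠ i` is absent
  -- and `z i` can be added instead.
  · by_cases h : ∃ m, m ≠ i ∧ Sum.inl (Sum.inr (m, false)) ∉ s
    · obtain ⟨m, hm, hms⟩ := h
      exact ⟨Sum.inl (Sum.inr (i, false)), rfl, mem_sum₃_iff.2 ⟨Finset.insert_nonempty _ _,
        injOn_insert_of_color hinj hi, Or.inr (Or.inl (hl.insert (Or.inl rfl))),
        ⟨m, by simpa [hm] using hms⟩, k, by simpa using hk⟩⟩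
    · push Not at h
      obtain ⟨m, hm⟩ := exists_fin_ne hd i
      have hms : Sum.inr (m, false) ∉ s := fun hms => by
        simpa using hinj (Finset.mem_coe.2 hms) (Finset.mem_coe.2 (h m hm)) rfl
      exact ⟨Sum.inr (i, false), rfl, mem_sum₃_iff.2 ⟨Finset.insert_nonempty _ _,
        injOn_insert_of_color hinj hi, Or.inr (Or.inl (hl.insert (Or.inr rfl))),
        ⟨j, by simpa using hj⟩, m, by simpa [hm] using hms⟩⟩
  · exact ⟨Sum.inr (i, true), rfl, mem_sum₃_iff.2 ⟨Finset.insert_nonempty _ _,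
      injOn_insert_of_color hinj hi, Or.inr (Or.inr (hl.insert (Or.inr rfl))),
      ⟨j, by simpa using hj⟩, k, by simpa using hk⟩⟩

theorem isBalancedHandleAddition_sum₃ (hd : 2 ≤ d) :
    IsBalancedHandleAddition d (sum₃ d) (color₃ d) (facetX d) (glueX d) where
  balanced := isBalanced_of_mem injOn_color_sum₃ (facetX_mem hd) card_facetX
  pure := isPure_sum₃ hd
  facet := isFacet_of_card injOn_color_sum₃ (facetX_mem hd) card_facetX
  facet' := isFacet_of_card injOn_color_sum₃ (image_glueX_mem hd) (by
    rw [image_glueX_facetX]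
    exact card_image_section (κ := color₃ d) fun _ => rfl)
  disjoint := by
    rw [image_glueX_facetX, facetX, Finset.disjoint_left]
    simp
  injOn := by
    intro u hu v hv huv
    simp only [facetX, Finset.coe_image, Set.mem_image] at hu hv
    obtain ⟨i, -, rfl⟩ := hu
    obtain ⟨j, -, rfl⟩ := hv
    simpa [glueX, color₃, color₂, color₁] using huv
  color := fun _ _ => rfl
  no_common_neighbor := by
    rintro v hv u ⟨⟨-, h1⟩, -, h2⟩
    obtain ⟨i, -, rfl⟩ := Finset.mem_image.1 hv
    -- Neighbors of an `x` lie in the first piece and neighbors of an `x'` in the third; these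
    -- pieces share no labels.
    have l1 : label₃ u = 0 ∨ label₃ u = 1 := by
      obtain ⟨-, -, hl | hl | hl, -⟩ := mem_sum₃_iff.1 h1
      · exact hl u (by simp)
      · simpa [label₃] using hl (Sum.inl (Sum.inl (i, false))) (by simp)
      · simpa [label₃] using hl (Sum.inl (Sum.inl (i, false))) (by simp)
    have l2 : label₃ u = 2 ∨ label₃ u = 3 := by
      obtain ⟨-, -, hl | hl | hl, -⟩ := mem_sum₃_iff.1 h2
      · simpa [label₃] using hl (Sum.inr (i, true)) (by simp [glueX, color₃, color₂, color₁])
      · simpa [label₃] using hl (Sum.inr (i, true)) (by simp [glueX, color₃, color₂, color₁])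
      · exact hl u (by simp)
    omega

/-- The vertices of `BM d`: `x i` for `k = 0`, `y i` for `k = 1`, `z i` for `k = 2`. -/
def vtx (i : Fin d) (k : Fin 3) : Vert₃ d :=
  ![Sum.inr (i, true), Sum.inl (Sum.inr (i, false)), Sum.inr (i, false)] k

@[simp]
theorem vtx_inj {i j : Fin d} {k l : Fin 3} : vtx i k = vtx j l ↔ i = j ∧ k = l := by
  fin_cases k <;> fin_cases l <;> simp [vtx]

@[simp]
theorem color₃_vtx (i : Fin d) (k : Fin 3) : color₃ d (vtx i k) = i := by
  fin_cases k <;> rfl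

theorem hasLabels_vtx_iff {s : Finset (Vert₃ d)} {k : Fin 3} :
    (∀ v ∈ s, ∃ i, v = vtx i k ∨ v = vtx i (k + 1)) ↔
      HasLabels label₃ (![3, 1, 2] k) (![3, 1, 2] (k + 1)) s := by
  refine forall₂_congr fun v _ => ?_
  fin_cases k <;> rcases v with (⟨i, _ | _⟩ | ⟨i, _ | _⟩) | ⟨i, _ | _⟩ <;> simp [vtx, label₃]

/-- This form is invariant under cyclic shifts of the three layers. -/
theorem mem_BM_iff_vtx {s : Finset (Vert₃ d)} :
    s ∈ BM d ↔ s.Nonempty ∧ Set.InjOn (color₃ d) s ∧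
      (∃ k, ∀ v ∈ s, ∃ i, v = vtx i k ∨ v = vtx i (k + 1)) ∧ ∀ k, ∃ i, vtx i k ∉ s := by
  rw [mem_BM_iff]
  simp only [hasLabels_vtx_iff, Fin.exists_fin_succ, Fin.forall_fin_succ]
  simp [vtx]
  tauto

theorem isBalanced_BM (hd : 2 ≤ d) : IsBalanced d (BM d) (color₃ d) := by
  -- A facet with one `y` and all other vertices `z`; since `2 ≤ d`, it contains no whole layer.
  refine isBalanced_of_mem (F := Finset.univ.image
    fun i : Fin d => vtx i (if i = ⟨0, by omega⟩ then 1 else 2)) (fun s hs => (mem_BM_iff.1 hs).2.1)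
    (mem_BM_iff_vtx.2 ⟨image_section_nonempty hd _, injOn_image_section fun i => color₃_vtx _ _,
      ⟨1, ?_⟩, ?_⟩) (card_image_section (κ := color₃ d) fun i => color₃_vtx _ _)
  · intro v hv
    obtain ⟨i, -, rfl⟩ := Finset.mem_image.1 hv
    refine ⟨i, ?_⟩
    split_ifs <;> simp
  · intro k
    obtain ⟨j, hj⟩ := exists_fin_ne hd ⟨0, by omega⟩
    refine ⟨if k = 1 then j else ⟨0, by omega⟩, ?_⟩
    fin_cases k <;> simp [hj]

theorem vertices_BM (hd : 2 ≤ d) :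
    vertices (BM d) = Set.range (fun p : Fin d × Fin 3 => vtx p.1 p.2) := by
  ext v
  change {v} ∈ BM d ↔ _
  rw [mem_BM_iff_vtx]
  constructor
  · rintro ⟨-, -, ⟨k, hk⟩, -⟩
    obtain ⟨i, h | h⟩ := hk v (by simp)
    exacts [⟨(i, k), h.symm⟩, ⟨(i, k + 1), h.symm⟩]
  · rintro ⟨⟨i, k⟩, rfl⟩
    refine ⟨by simp, by simp, ⟨k, fun v hv => ⟨i, Or.inl (by simpa using hv)⟩⟩, fun l => ?_⟩
    obtain ⟨j, hj⟩ := exists_fin_ne hd i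
    exact ⟨j, by simp [hj]⟩

theorem ncard_vertices_BM (hd : 2 ≤ d) : (vertices (BM d)).ncard = 3 * d := by
  rw [vertices_BM hd, ← Set.image_univ, Set.ncard_image_of_injective _ ?_, Set.ncard_univ]
  · simp [mul_comm]
  · rintro ⟨i, k⟩ ⟨j, l⟩ h
    simpa using h

end Constructions

/-! ### Vectors of mixed sign as pairs of a direction and a level -/

section Profile

variable {n : ℕ}

/-- The coordinates of a point of `ℝ^{n+1}`, preceded by `0`: representatives of `ℝ^{n+2}` modulo
the constant vectors. -/
def height (x : EuclideanSpace ℝ (Fin (n + 1))) : Fin (n + 2) → ℝ :=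
  Fin.cons 0 (fun i => x i)

/-- The largest coordinate of `height x`. -/
noncomputable def maxHeight (x : EuclideanSpace ℝ (Fin (n + 1))) : ℝ :=
  Finset.univ.sup' Finset.univ_nonempty (height x)

/-- The smallest coordinate of `height x`. -/
noncomputable def minHeight (x : EuclideanSpace ℝ (Fin (n + 1))) : ℝ :=
  Finset.univ.inf' Finset.univ_nonempty (height x)

theorem height_zero_index (x : EuclideanSpace ℝ (Fin (n + 1))) : height x 0 = 0 := rfl

theorem height_succ (x : EuclideanSpace ℝ (Fin (n + 1))) (i : Fin (n + 1)) :
    height x i.succ = x i := rfl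

theorem height_neg (x : EuclideanSpace ℝ (Fin (n + 1))) (i : Fin (n + 2)) :
    height (-x) i = -height x i := by
  refine Fin.cases ?_ (fun i => ?_) i <;> simp [height]

theorem continuous_height (i : Fin (n + 2)) :
    Continuous fun x : EuclideanSpace ℝ (Fin (n + 1)) => height x i := by
  refine Fin.cases ?_ (fun i => ?_) i
  · simpa [height] using continuous_const
  · simp only [height_succ]
    fun_prop

theorem continuous_maxHeight : Continuous (maxHeight (n := n)) :=
  Continuous.finset_sup'_apply _ fun i _ => continuous_height i

theorem continuous_minHeight : Continuous (minHeight (n := n)) :=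
  Continuous.finset_inf'_apply _ fun i _ => continuous_height i

theorem height_le_maxHeight (x : EuclideanSpace ℝ (Fin (n + 1))) (i : Fin (n + 2)) :
    height x i ≤ maxHeight x := Finset.le_sup' (height x) (Finset.mem_univ i)

theorem minHeight_le_height (x : EuclideanSpace ℝ (Fin (n + 1))) (i : Fin (n + 2)) :
    minHeight x ≤ height x i := Finset.inf'_le (height x) (Finset.mem_univ i)

theorem exists_height_eq_maxHeight (x : EuclideanSpace ℝ (Fin (n + 1))) :
    ∃ i, height x i = maxHeight x := by
  obtain ⟨i, -, h⟩ := Finset.exists_mem_eq_sup' Finset.univ_nonempty (height x)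
  exact ⟨i, h.symm⟩

theorem exists_height_eq_minHeight (x : EuclideanSpace ℝ (Fin (n + 1))) :
    ∃ i, height x i = minHeight x := by
  obtain ⟨i, -, h⟩ := Finset.exists_mem_eq_inf' Finset.univ_nonempty (height x)
  exact ⟨i, h.symm⟩

theorem maxHeight_neg (x : EuclideanSpace ℝ (Fin (n + 1))) : maxHeight (-x) = -minHeight x := by
  apply le_antisymm
  · obtain ⟨i, hi⟩ := exists_height_eq_maxHeight (-x)
    rw [← hi, height_neg]
    linarith [minHeight_le_height x i]
  · obtain ⟨i, hi⟩ := exists_height_eq_minHeight x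
    rw [← hi, ← height_neg]
    exact height_le_maxHeight _ i

theorem minHeight_neg (x : EuclideanSpace ℝ (Fin (n + 1))) : minHeight (-x) = -maxHeight x := by
  have := maxHeight_neg (-x)
  rw [neg_neg] at this
  linarith

/-- One entry of `height x` is `0`, so constant heights would force `x = 0`. -/
theorem minHeight_lt_maxHeight {x : EuclideanSpace ℝ (Fin (n + 1))} (hx : x ≠ 0) :
    minHeight x < maxHeight x := by
  by_contra! h
  refine hx (PiLp.ext fun i => ?_)
  have h1 := height_le_maxHeight x i.succ
  have h2 := minHeight_le_height x i.succ
  have h3 := height_le_maxHeight x 0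
  have h4 := minHeight_le_height x 0
  rw [height_zero_index] at h3 h4
  rw [height_succ] at h1 h2
  simp only [PiLp.zero_apply]
  linarith

/-- The heights of `x` relative to the level that decreases linearly from the maximum at `s = 0` to
the minimum at `s = 1`. -/
noncomputable def profile (x : EuclideanSpace ℝ (Fin (n + 1))) (s : ℝ) (i : Fin (n + 2)) : ℝ :=
  height x i - ((1 - s) * maxHeight x + s * minHeight x)

/-- The `ℓ¹`-norm of `profile x s`. -/
noncomputable def mass (x : EuclideanSpace ℝ (Fin (n + 1))) (s : ℝ) : ℝ :=
  ∑ i, |profile x s i|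

theorem continuous_profile (i : Fin (n + 2)) :
    Continuous fun p : EuclideanSpace ℝ (Fin (n + 1)) × ℝ => profile p.1 p.2 i := by
  have h1 := continuous_height (n := n) i
  have h2 := continuous_maxHeight (n := n)
  have h3 := continuous_minHeight (n := n)
  unfold profile
  fun_prop

theorem continuous_mass :
    Continuous fun p : EuclideanSpace ℝ (Fin (n + 1)) × ℝ => mass p.1 p.2 :=
  continuous_finsetSum _ fun i _ => (continuous_profile i).abs

/-- Negation exchanges maximum and minimum and hence reverses the level. This symmetry is the source
of the antipodal gluing. -/
theorem profile_neg (x : EuclideanSpace ℝ (Fin (n + 1))) (s : ℝ) (i : Fin (n + 2)) :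
    profile (-x) (1 - s) i = -profile x s i := by
  simp only [profile, maxHeight_neg, minHeight_neg, height_neg]
  ring

theorem mass_neg (x : EuclideanSpace ℝ (Fin (n + 1))) (s : ℝ) :
    mass (-x) (1 - s) = mass x s := by
  simp only [mass, profile_neg, abs_neg]

theorem mass_pos {x : EuclideanSpace ℝ (Fin (n + 1))} (hx : x ≠ 0) (s : ℝ) : 0 < mass x s := by
  refine (Finset.sum_nonneg fun i _ => abs_nonneg _).lt_of_ne' fun h => ?_
  have h0 := (Finset.sum_eq_zero_iff_of_nonneg fun i _ => abs_nonneg _).1 h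
  obtain ⟨i, hi⟩ := exists_height_eq_maxHeight x
  obtain ⟨j, hj⟩ := exists_height_eq_minHeight x
  have hi0 := abs_eq_zero.1 (h0 i (Finset.mem_univ i))
  have hj0 := abs_eq_zero.1 (h0 j (Finset.mem_univ j))
  simp only [profile, hi, hj] at hi0 hj0
  linarith [minHeight_lt_maxHeight hx]

theorem exists_profile_nonpos {x : EuclideanSpace ℝ (Fin (n + 1))} (hx : x ≠ 0) {s : ℝ}
    (hs : s ≤ 1) : ∃ i, profile x s i ≤ 0 := by
  obtain ⟨i, hi⟩ := exists_height_eq_minHeight x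
  refine ⟨i, ?_⟩
  rw [profile, hi]
  nlinarith [minHeight_lt_maxHeight hx]

theorem exists_profile_nonneg {x : EuclideanSpace ℝ (Fin (n + 1))} (hx : x ≠ 0) {s : ℝ}
    (hs : 0 ≤ s) : ∃ i, 0 ≤ profile x s i := by
  obtain ⟨i, hi⟩ := exists_height_eq_maxHeight x
  refine ⟨i, ?_⟩
  rw [profile, hi]
  nlinarith [minHeight_lt_maxHeight hx]

theorem one_le_of_profile_nonneg {x : EuclideanSpace ℝ (Fin (n + 1))} (hx : x ≠ 0) {s : ℝ}
    (h : ∀ i, 0 ≤ profile x s i) : 1 ≤ s := by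
  obtain ⟨i, hi⟩ := exists_height_eq_minHeight x
  have := h i
  rw [profile, hi] at this
  by_contra!
  nlinarith [minHeight_lt_maxHeight hx]

theorem profile_one_nonneg (x : EuclideanSpace ℝ (Fin (n + 1))) (i : Fin (n + 2)) :
    0 ≤ profile x 1 i := by
  have := minHeight_le_height x i
  simp only [profile]
  linarith

/-- A positive multiple of the profile of a unit vector determines the vector and the level. -/
theorem eq_of_profile_proportional {x y : EuclideanSpace ℝ (Fin (n + 1))} (hx : ‖x‖ = 1)
    (hy : ‖y‖ = 1) {s t c : ℝ} (hc : 0 < c) (h : ∀ i, profile y t i = c * profile x s i) :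
    y = x ∧ t = s := by
  -- Subtracting the entry with index `0` cancels the level.
  have hyx : y = c • x := by
    refine PiLp.ext fun i => ?_
    have h0 := h 0
    have hi := h i.succ
    simp only [profile, height_zero_index, height_succ] at h0 hi
    simp only [PiLp.smul_apply, smul_eq_mul]
    linarith
  have hc1 : c = 1 := by
    rw [hyx, norm_smul, hx, mul_one, Real.norm_eq_abs, abs_of_pos hc] at hy
    exact hy
  subst hc1
  rw [one_smul] at hyx
  subst hyx
  refine ⟨rfl, ?_⟩
  have hne : y ≠ 0 := by
    rintro rfl
    simp at hx
  have h0 := h 0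
  simp only [profile] at h0
  have hlt := minHeight_lt_maxHeight hne
  have : (t - s) * (maxHeight y - minHeight y) = 0 := by linarith
  rcases mul_eq_zero.1 this with h | h <;> linarith

/-- Every nonzero vector that is neither positive nor negative is a positive multiple of the profile
of a unit vector. -/
theorem exists_profile_eq {u : Fin (n + 2) → ℝ} (h0 : u ≠ 0) (hneg : ∃ i, u i ≤ 0)
    (hpos : ∃ i, 0 ≤ u i) :
    ∃ x : EuclideanSpace ℝ (Fin (n + 1)), ‖x‖ = 1 ∧ ∃ s ∈ Set.Icc (0 : ℝ) 1, ∃ c : ℝ, 0 < c ∧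
      ∀ i, u i = c * profile x s i := by
  -- The class of `u` modulo constant vectors; it is nonzero because a constant vector with both a
  -- nonpositive and a nonnegative entry vanishes.
  set y : EuclideanSpace ℝ (Fin (n + 1)) := WithLp.toLp 2 fun i => u i.succ - u 0 with hy
  have hheight : ∀ i, height y i = u i - u 0 := by
    intro i
    refine Fin.cases ?_ (fun i => ?_) i
    · simp [height_zero_index]
    · simp [height_succ, hy]
  obtain ⟨i₁, h1⟩ := hneg
  obtain ⟨i₂, h2⟩ := hpos
  have hy0 : y ≠ 0 := by
    intro hy0
    have hc : ∀ i, u i = u 0 := fun i => by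
      have := hheight i
      rw [hy0] at this
      have h0 : height (0 : EuclideanSpace ℝ (Fin (n + 1))) i = 0 := by
        refine Fin.cases ?_ (fun i => ?_) i <;> simp [height]
      linarith
    refine h0 (funext fun i => ?_)
    have e1 := hc i₁
    have e2 := hc i₂
    have e := hc i
    simp only [Pi.zero_apply]
    linarith
  have hr : 0 < ‖y‖ := norm_pos_iff.2 hy0
  set x := ‖y‖⁻¹ • y with hx
  have hxh : ∀ i, height x i = ‖y‖⁻¹ * (u i - u 0) := by
    intro i
    rw [← hheight]
    refine Fin.cases ?_ (fun i => ?_) i <;> simp [height, hx]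
  have hx1 : ‖x‖ = 1 := by
    rw [hx, norm_smul, norm_inv, norm_norm, inv_mul_cancel₀ hr.ne']
  have hx0 : x ≠ 0 := by
    intro h
    simp [h] at hx1
  have hlt := minHeight_lt_maxHeight hx0
  set c := -(‖y‖⁻¹ * u 0) with hc
  have hri : 0 < ‖y‖⁻¹ := inv_pos.2 hr
  have hcm : minHeight x ≤ c := by
    refine (minHeight_le_height x i₁).trans ?_
    rw [hxh]
    nlinarith
  have hcM : c ≤ maxHeight x := by
    refine le_trans ?_ (height_le_maxHeight x i₂)
    rw [hxh]
    nlinarith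
  refine ⟨x, hx1, (maxHeight x - c) / (maxHeight x - minHeight x), ⟨?_, ?_⟩, ‖y‖, hr, fun i => ?_⟩
  · exact div_nonneg (by linarith) (by linarith)
  · rw [div_le_one (by linarith)]
    linarith
  · have hd : maxHeight x - minHeight x ≠ 0 := by linarith
    have hlevel : (1 - (maxHeight x - c) / (maxHeight x - minHeight x)) * maxHeight x +
        (maxHeight x - c) / (maxHeight x - minHeight x) * minHeight x = c := by
      field_simp
      ring
    rw [profile, hlevel, hxh, hc]
    field_simp
    ring

end Profile

/-! ### Parametrization of the three cylinders and their intersections -/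

section Cylinders

variable {n : ℕ}

theorem sum_eq_sum_vtx {d : ℕ} {w : Vert₃ d → ℝ} (hw : ∀ v, (∀ i k, v ≠ vtx i k) → w v = 0) :
    ∑ v, w v = ∑ i, ∑ k, w (vtx i k) := by
  have h1 : ∀ i b, w (Sum.inl (Sum.inl (i, b))) = 0 := fun i b => hw _ fun j k => by
    fin_cases k <;> simp [vtx]
  have h2 : ∀ i, w (Sum.inl (Sum.inr (i, true))) = 0 := fun i => hw _ fun j k => by
    fin_cases k <;> simp [vtx]
  simp only [Fintype.sum_sum_type, Fintype.sum_prod_type, Fintype.sum_bool, Fin.sum_univ_three, vtx,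
    h1, h2, Matrix.cons_val, Finset.sum_add_distrib, Finset.sum_const_zero]
  ring

/-- The point of the `k`-th cylinder over `x` at time `s`, in barycentric coordinates. -/
noncomputable def cylinderPoint (x : EuclideanSpace ℝ (Fin (n + 1))) (s : ℝ) (k : Fin 3)
    (v : Vert₃ (n + 2)) : ℝ :=
  if v = vtx (color₃ _ v) (k + 1) then max (profile x s (color₃ _ v)) 0 / mass x s
  else if v = vtx (color₃ _ v) k then max (-profile x s (color₃ _ v)) 0 / mass x s
  else 0

theorem fin_three_cases (k l : Fin 3) : l = k ∨ l = k + 1 ∨ l = k + 2 := by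
  revert k l
  decide

theorem cylinderPoint_vtx_succ (x : EuclideanSpace ℝ (Fin (n + 1))) (s : ℝ) (k : Fin 3)
    (i : Fin (n + 2)) :
    cylinderPoint x s k (vtx i (k + 1)) = max (profile x s i) 0 / mass x s := by
  simp [cylinderPoint]

theorem cylinderPoint_vtx_self (x : EuclideanSpace ℝ (Fin (n + 1))) (s : ℝ) (k : Fin 3)
    (i : Fin (n + 2)) :
    cylinderPoint x s k (vtx i k) = max (-profile x s i) 0 / mass x s := by
  simp [cylinderPoint]

theorem cylinderPoint_eq_zero {x : EuclideanSpace ℝ (Fin (n + 1))} {s : ℝ} {k : Fin 3}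
    {v : Vert₃ (n + 2)} (h1 : ∀ i, v ≠ vtx i (k + 1)) (h2 : ∀ i, v ≠ vtx i k) :
    cylinderPoint x s k v = 0 := by
  simp [cylinderPoint, h1, h2]

theorem continuous_cylinderPoint (k : Fin 3) (v : Vert₃ (n + 2)) :
    Continuous fun p : {x : EuclideanSpace ℝ (Fin (n + 1)) // x ≠ 0} × ℝ =>
      cylinderPoint p.1.1 p.2 k v := by
  have hq : Continuous fun p : {x : EuclideanSpace ℝ (Fin (n + 1)) // x ≠ 0} × ℝ => (p.1.1, p.2) := by
    fun_prop
  have hp := (continuous_profile (n := n) (color₃ _ v)).comp hq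
  have hm := (continuous_mass (n := n)).comp hq
  have hm0 : ∀ p : {x : EuclideanSpace ℝ (Fin (n + 1)) // x ≠ 0} × ℝ, mass p.1.1 p.2 ≠ 0 :=
    fun p => (mass_pos p.1.2 p.2).ne'
  unfold cylinderPoint
  split_ifs
  · exact (hp.max continuous_const).div hm hm0
  · exact (hp.neg.max continuous_const).div hm hm0
  · exact continuous_const

theorem cylinderPoint_nonneg {x : EuclideanSpace ℝ (Fin (n + 1))} (hx : x ≠ 0) (s : ℝ) (k : Fin 3)
    (v : Vert₃ (n + 2)) : 0 ≤ cylinderPoint x s k v := by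
  have := mass_pos hx s
  unfold cylinderPoint
  split_ifs <;> positivity

theorem sum_vtx_eq {d : ℕ} (w : Vert₃ d → ℝ) (k : Fin 3) (i : Fin d) :
    ∑ l, w (vtx i l) = w (vtx i k) + w (vtx i (k + 1)) + w (vtx i (k + 2)) := by
  fin_cases k <;> simp [Fin.sum_univ_three] <;> ring_nf

theorem cylinderPoint_vtx_add_two (x : EuclideanSpace ℝ (Fin (n + 1))) (s : ℝ) (k : Fin 3)
    (i : Fin (n + 2)) : cylinderPoint x s k (vtx i (k + 2)) = 0 := by
  apply cylinderPoint_eq_zero <;> intro j <;> fin_cases k <;> simp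

theorem sum_cylinderPoint {x : EuclideanSpace ℝ (Fin (n + 1))} (hx : x ≠ 0) (s : ℝ) (k : Fin 3) :
    ∑ v, cylinderPoint x s k v = 1 := by
  rw [sum_eq_sum_vtx fun v hv => cylinderPoint_eq_zero (fun i => hv i _) fun i => hv i _]
  simp only [sum_vtx_eq _ k, cylinderPoint_vtx_self, cylinderPoint_vtx_succ,
    cylinderPoint_vtx_add_two, add_zero, ← add_div]
  rw [← Finset.sum_div, div_eq_one_iff_eq (mass_pos hx s).ne']
  refine Finset.sum_congr rfl fun i _ => ?_
  rcases le_total (profile x s i) 0 with h | h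
  · rw [max_eq_left (by linarith), max_eq_right h, abs_of_nonpos h, add_zero]
  · rw [max_eq_right (by linarith), max_eq_left h, abs_of_nonneg h, zero_add]

/-- The support is a face: the sign of the profile at a color selects one layer, so no color occurs
twice, and a whole layer would need a profile that is everywhere positive or everywhere negative. -/
theorem cylinderPoint_mem {x : EuclideanSpace ℝ (Fin (n + 1))} (hx : x ≠ 0) {s : ℝ}
    (hs : s ∈ Set.Icc (0 : ℝ) 1) (k : Fin 3) :
    cylinderPoint x s k ∈ realization (BM (n + 2)) := by
  classical
  have hsum := sum_cylinderPoint hx s k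
  have hcases : ∀ v, cylinderPoint x s k v ≠ 0 →
      (v = vtx (color₃ _ v) (k + 1) ∧ 0 < profile x s (color₃ _ v)) ∨
      (v = vtx (color₃ _ v) k ∧ profile x s (color₃ _ v) < 0) := by
    intro v hv
    unfold cylinderPoint at hv
    split_ifs at hv with h1 h2
    · refine Or.inl ⟨h1, ?_⟩
      by_contra! h
      simp [max_eq_right h] at hv
    · refine Or.inr ⟨h2, ?_⟩
      by_contra! h
      simp [max_eq_right (neg_nonpos.2 h)] at hv
    · exact absurd rfl hv
  refine ⟨⟨cylinderPoint_nonneg hx s k, hsum⟩,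
    Finset.univ.filter fun v => cylinderPoint x s k v ≠ 0, ?_, ?_⟩
  · refine mem_BM_iff_vtx.2 ⟨?_, ?_, ⟨k, ?_⟩, ?_⟩
    · by_contra h
      rw [Finset.not_nonempty_iff_eq_empty, Finset.filter_eq_empty_iff] at h
      rw [Finset.sum_eq_zero fun v hv => not_not.1 (h hv)] at hsum
      exact zero_ne_one hsum
    · intro u hu v hv huv
      simp only [Finset.coe_filter, Finset.mem_univ, true_and, Set.mem_ofPred_eq] at hu hv
      rcases hcases u hu with ⟨h1, h2⟩ | ⟨h1, h2⟩ <;> rcases hcases v hv with ⟨h3, h4⟩ | ⟨h3, h4⟩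
      · rw [h1, h3, huv]
      · rw [huv] at h2
        linarith
      · rw [huv] at h2
        linarith
      · rw [h1, h3, huv]
    · intro v hv
      rcases hcases v (by simpa using hv) with ⟨h, -⟩ | ⟨h, -⟩
      exacts [⟨_, Or.inr h⟩, ⟨_, Or.inl h⟩]
    · intro l
      simp only [Finset.mem_filter, Finset.mem_univ, true_and, not_not]
      rcases fin_three_cases k l with rfl | rfl | rfl
      · obtain ⟨i, hi⟩ := exists_profile_nonneg hx hs.1
        exact ⟨i, by rw [cylinderPoint_vtx_self, max_eq_right (by linarith), zero_div]⟩
      · obtain ⟨i, hi⟩ := exists_profile_nonpos hx hs.2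
        exact ⟨i, by rw [cylinderPoint_vtx_succ, max_eq_right hi, zero_div]⟩
      · exact ⟨0, cylinderPoint_vtx_add_two _ _ _ _⟩
  · intro v hv
    simpa using hv

/-- Subtracting the weights in layer `k` from those in layer `k + 1` gives a signed vector. Nothing
is lost, since no color has weight in both layers, and the missing vertex of each layer supplies the
sign conditions of `exists_profile_eq`. -/
theorem exists_cylinderPoint_eq {w : Vert₃ (n + 2) → ℝ} (hw : w ∈ realization (BM (n + 2))) :
    ∃ x : EuclideanSpace ℝ (Fin (n + 1)), ‖x‖ = 1 ∧ ∃ s ∈ Set.Icc (0 : ℝ) 1, ∃ k,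
      cylinderPoint x s k = w := by
  obtain ⟨⟨hnn, hsum⟩, t, ht, hwt⟩ := hw
  obtain ⟨-, hinj, ⟨k, hk⟩, hmiss⟩ := mem_BM_iff_vtx.1 ht
  have hzero : ∀ v, (∀ i, v ≠ vtx i (k + 1)) → (∀ i, v ≠ vtx i k) → w v = 0 := by
    intro v h1 h2
    refine hwt v fun hv => ?_
    obtain ⟨i, h | h⟩ := hk v hv
    exacts [h2 i h, h1 i h]
  have htwo : ∀ i, w (vtx i (k + 2)) = 0 := by
    intro i
    apply hzero <;> intro j <;> fin_cases k <;> simp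
  have hor : ∀ i, w (vtx i k) = 0 ∨ w (vtx i (k + 1)) = 0 := by
    intro i
    by_contra! h
    have := hinj (Finset.mem_coe.2 (not_imp_comm.1 (hwt _) h.1))
      (Finset.mem_coe.2 (not_imp_comm.1 (hwt _) h.2)) (by simp)
    simp at this
  set u : Fin (n + 2) → ℝ := fun i => w (vtx i (k + 1)) - w (vtx i k) with hu
  have hup : ∀ i, max (u i) 0 = w (vtx i (k + 1)) := by
    intro i
    have h1 := hnn (vtx i k)
    have h2 := hnn (vtx i (k + 1))
    rcases hor i with h | h
    · simp only [hu, h, sub_zero]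
      exact max_eq_left h2
    · simp only [hu, h, zero_sub]
      exact max_eq_right (by linarith)
  have hum : ∀ i, max (-u i) 0 = w (vtx i k) := by
    intro i
    have h1 := hnn (vtx i k)
    have h2 := hnn (vtx i (k + 1))
    rcases hor i with h | h
    · simp only [hu, h, sub_zero]
      exact max_eq_right (by linarith)
    · simp only [hu, h, zero_sub, neg_neg]
      exact max_eq_left h1
  have habs : ∑ i, |u i| = 1 := by
    rw [← hsum, sum_eq_sum_vtx fun v hv => hzero v (fun i => hv i _) fun i => hv i _]
    refine Finset.sum_congr rfl fun i _ => ?_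
    rw [sum_vtx_eq w k, htwo, add_zero, ← hup, ← hum]
    rcases le_total (u i) 0 with h | h
    · rw [max_eq_left (by linarith), max_eq_right h, abs_of_nonpos h, add_zero]
    · rw [max_eq_right (by linarith), max_eq_left h, abs_of_nonneg h, zero_add]
  have hu0 : u ≠ 0 := by
    intro h
    simp [h] at habs
  obtain ⟨i₁, h1⟩ := hmiss (k + 1)
  obtain ⟨i₂, h2⟩ := hmiss k
  obtain ⟨x, hx, s, hs, c, hc, hprof⟩ := exists_profile_eq hu0
    ⟨i₁, by have := hnn (vtx i₁ k); simp only [hu, hwt _ h1]; linarith⟩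
    ⟨i₂, by have := hnn (vtx i₂ (k + 1)); simp only [hu, hwt _ h2]; linarith⟩
  have hx0 : x ≠ 0 := by
    rintro rfl
    simp at hx
  -- The weights sum to `1`, which identifies the scaling factor with that of `cylinderPoint`.
  have hcm : c * mass x s = 1 := by
    rw [← habs, mass, Finset.mul_sum]
    refine Finset.sum_congr rfl fun i _ => ?_
    rw [hprof, abs_mul, abs_of_pos hc]
  have hm := mass_pos hx0 s
  have hc' : c = 1 / mass x s := by
    field_simp
    linarith
  refine ⟨x, hx, s, hs, k, funext fun v => ?_⟩
  by_cases hv1 : ∃ i, v = vtx i (k + 1)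
  · obtain ⟨i, rfl⟩ := hv1
    rw [cylinderPoint_vtx_succ, ← hup, hprof, hc', ← max_div_div_right hm.le]
    simp only [zero_div]
    ring_nf
  by_cases hv2 : ∃ i, v = vtx i k
  · obtain ⟨i, rfl⟩ := hv2
    rw [cylinderPoint_vtx_self, ← hum, hprof, hc', ← max_div_div_right hm.le]
    simp only [zero_div]
    ring_nf
  · push Not at hv1 hv2
    rw [cylinderPoint_eq_zero hv1 hv2, hzero v hv1 hv2]

theorem cylinderPoint_sub (x : EuclideanSpace ℝ (Fin (n + 1))) (s : ℝ) (k : Fin 3)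
    (i : Fin (n + 2)) : cylinderPoint x s k (vtx i (k + 1)) - cylinderPoint x s k (vtx i k) =
      profile x s i / mass x s := by
  rw [cylinderPoint_vtx_self, cylinderPoint_vtx_succ, ← sub_div]
  congr 1
  rcases le_total (profile x s i) 0 with h | h
  · rw [max_eq_right h, max_eq_left (by linarith)]
    ring
  · rw [max_eq_left h, max_eq_right (by linarith)]
    ring

/-- Both points are supported on layer `k + 1`, which has positive sign in cylinder `k` and negative
sign in cylinder `k + 1`. The change of sign is the passage from `x` to `-x`. -/
theorem cylinderPoint_one_eq (x : EuclideanSpace ℝ (Fin (n + 1))) (k : Fin 3) :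
    cylinderPoint x 1 k = cylinderPoint (-x) 0 (k + 1) := by
  have hp : ∀ i, profile (-x) 0 i = -profile x 1 i := fun i => by
    rw [← profile_neg, sub_self]
  have hm : mass (-x) 0 = mass x 1 := by rw [← mass_neg x, sub_self]
  have h11 : k + 1 + 1 = k + 2 := by rw [add_assoc]; rfl
  funext v
  by_cases hv : ∃ i l, v = vtx i l
  · obtain ⟨i, l, rfl⟩ := hv
    have h0 := profile_one_nonneg x i
    rcases fin_three_cases k l with rfl | rfl | rfl
    -- Layer `k` is the one that cylinder `k + 1` does not use.
    · have : l = l + 1 + 2 := by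
        revert l
        decide
      conv_rhs => rw [this]
      rw [show l + 1 + 2 + 1 = l + 1 by revert l; decide, cylinderPoint_vtx_add_two,
        cylinderPoint_vtx_self, max_eq_right (by linarith), zero_div]
    · rw [cylinderPoint_vtx_succ, cylinderPoint_vtx_self, hp, neg_neg, hm]
    · rw [cylinderPoint_vtx_add_two, ← h11, cylinderPoint_vtx_succ, hp, max_eq_right (by linarith),
        zero_div]
  · push Not at hv
    rw [cylinderPoint_eq_zero (fun i => hv i _) fun i => hv i _,
      cylinderPoint_eq_zero (fun i => hv i _) fun i => hv i _]

theorem ne_zero_of_norm_eq_one {x : EuclideanSpace ℝ (Fin (n + 1))} (hx : ‖x‖ = 1) : x ≠ 0 := by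
  rintro rfl
  simp at hx

theorem eq_of_cylinderPoint_eq_self {x y : EuclideanSpace ℝ (Fin (n + 1))} (hx : ‖x‖ = 1)
    (hy : ‖y‖ = 1) {s t : ℝ} {k : Fin 3} (h : cylinderPoint x s k = cylinderPoint y t k) :
    y = x ∧ t = s := by
  have hmx := mass_pos (ne_zero_of_norm_eq_one hx) s
  have hmy := mass_pos (ne_zero_of_norm_eq_one hy) t
  refine eq_of_profile_proportional hx hy (div_pos hmy hmx) fun i => ?_
  have := cylinderPoint_sub x s k i
  rw [h, cylinderPoint_sub] at this
  field_simp at this ⊢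
  linarith

/-- Cylinder `k + 1` has no weight in layer `k`, so the profile of `x` has no negative entry. This
forces the final level `s = 1`, and injectivity within cylinder `k + 1` gives the rest. -/
theorem eq_of_cylinderPoint_eq_succ {x y : EuclideanSpace ℝ (Fin (n + 1))} (hx : ‖x‖ = 1)
    (hy : ‖y‖ = 1) {s t : ℝ} (hs : s ≤ 1) {k : Fin 3}
    (h : cylinderPoint x s k = cylinderPoint y t (k + 1)) :
    y = -x ∧ s = 1 ∧ t = 0 := by
  have hmx := mass_pos (ne_zero_of_norm_eq_one hx) s
  have hnn : ∀ i, 0 ≤ profile x s i := by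
    intro i
    have h1 := cylinderPoint_vtx_self x s k i
    rw [h, cylinderPoint_eq_zero (by intro j; fin_cases k <;> simp)
      (by intro j; fin_cases k <;> simp)] at h1
    by_contra! hlt
    have : 0 < max (-profile x s i) 0 / mass x s :=
      div_pos (lt_max_of_lt_left (by linarith)) hmx
    linarith
  have hs1 : s = 1 := le_antisymm hs (one_le_of_profile_nonneg (ne_zero_of_norm_eq_one hx) hnn)
  subst hs1
  rw [cylinderPoint_one_eq] at h
  obtain ⟨h1, h2⟩ := eq_of_cylinderPoint_eq_self (by rwa [norm_neg]) hy h
  exact ⟨h1, rfl, h2⟩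

end Cylinders

/-! ### Quotient maps and mapping tori -/

section Quotients

theorem exists_homeomorph_of_isQuotientMap {X Y Z : Type*} [TopologicalSpace X] [TopologicalSpace Y]
    [TopologicalSpace Z] {f : X → Y} {g : X → Z} (hf : Topology.IsQuotientMap f)
    (hg : Topology.IsQuotientMap g) (h : ∀ a b, f a = f b ↔ g a = g b) :
    ∃ e : Y ≃ₜ Z, ∀ a, e (f a) = g a := by
  choose s hs using hf.surjective
  choose t ht using hg.surjective
  have h1 : ∀ a, g (s (f a)) = g a := fun a => (h _ _).1 (hs _)
  have h2 : ∀ a, f (t (g a)) = f a := fun a => (h _ _).2 (ht _)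
  refine ⟨⟨⟨g ∘ s, f ∘ t, fun y => ?_, fun z => ?_⟩, ?_, ?_⟩, h1⟩
  · simp only [Function.comp_apply]
    rw [h2, hs]
  · simp only [Function.comp_apply]
    rw [h1, ht]
  · rw [hf.continuous_iff]
    exact hg.continuous.congr fun a => (h1 a).symm
  · rw [hg.continuous_iff]
    exact hf.continuous.congr fun a => (h2 a).symm

theorem isQuotientMap_of_compact {X Y : Type*} [TopologicalSpace X] [TopologicalSpace Y]
    [CompactSpace X] [T2Space Y] {f : X → Y} (hf : Continuous f) (hs : Function.Surjective f) :
    Topology.IsQuotientMap f :=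
  hf.isClosedMap.isQuotientMap hf hs

/-- `π` exhibits `N` as the mapping torus of `τ`: the quotient of `S × [0, 1]` that identifies
`(x, 0)` with `(τ x, 1)`. -/
structure IsMappingTorus {S N : Type*} [TopologicalSpace S] [TopologicalSpace N] (τ : S → S)
    (π : S × unitInterval → N) : Prop where
  isQuotientMap : Topology.IsQuotientMap π
  eq_iff : ∀ p q, π p = π q ↔ p = q ∨ (p.2 = 0 ∧ q.2 = 1 ∧ q.1 = τ p.1) ∨
    (q.2 = 0 ∧ p.2 = 1 ∧ p.1 = τ q.1)

theorem isMappingTorus_quot {S : Type*} [TopologicalSpace S] {τ : S → S}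
    (hτ : Function.Injective τ) {r : S × unitInterval → S × unitInterval → Prop}
    (hr : ∀ p q, r p q ↔ p.2 = 0 ∧ q.2 = 1 ∧ q.1 = τ p.1) : IsMappingTorus τ (Quot.mk r) where
  isQuotientMap := isQuotientMap_quot_mk
  eq_iff := by
    intro p q
    rw [← hr, ← hr]
    constructor
    · intro h
      replace h := Quot.eqvGen_exact h
      induction h with
      | rel p q h => exact Or.inr (Or.inl h)
      | refl p => exact Or.inl rfl
      | symm p q h ih =>
        rcases ih with h | h | h
        exacts [Or.inl h.symm, Or.inr (Or.inr h), Or.inr (Or.inl h)]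
      -- Identifications do not chain: a point at time `0` is not at time `1`, and two points
      -- identified with the same point agree, by injectivity of `τ` when the common point is at
      -- time `1`.
      | trans p q s h1 h2 h1' h2' =>
        rcases h1' with rfl | h1' | h1'
        · exact h2'
        · rcases h2' with rfl | h2' | h2'
          · exact Or.inr (Or.inl h1')
          · rw [hr] at h1' h2'
            exact absurd (h1'.2.1.symm.trans h2'.1) one_ne_zero
          · rw [hr] at h1' h2'
            refine Or.inl (Prod.ext (hτ ?_) (h1'.1.trans h2'.1.symm))
            rw [← h1'.2.2, ← h2'.2.2]
        · rcases h2' with rfl | h2' | h2'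
          · exact Or.inr (Or.inr h1')
          · rw [hr] at h1' h2'
            exact Or.inl (Prod.ext (h1'.2.2.trans h2'.2.2.symm) (h1'.2.1.trans h2'.2.1.symm))
          · rw [hr] at h1' h2'
            exact absurd (h2'.2.1.symm.trans h1'.1) one_ne_zero
    · rintro (rfl | h | h)
      exacts [rfl, Quot.sound h, (Quot.sound h).symm]

theorem circleExp_two_pi_mul_eq_iff (s t : unitInterval) :
    Circle.exp (2 * Real.pi * s) = Circle.exp (2 * Real.pi * t) ↔
      s = t ∨ (s = 0 ∧ t = 1) ∨ (t = 0 ∧ s = 1) := by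
  constructor
  · intro h
    obtain ⟨m, hm⟩ := Circle.exp_eq_exp.1 h
    have hst : (s : ℝ) = t + m := by
      have : 2 * Real.pi * ((s : ℝ) - (t + m)) = 0 := by linarith
      rcases mul_eq_zero.1 this with h | h
      · exact absurd h Real.two_pi_pos.ne'
      · linarith
    have hs := s.2
    have ht := t.2
    have h1 : (-2 : ℝ) < m := by linarith [hs.1, ht.2]
    have h2 : (m : ℝ) < 2 := by linarith [hs.2, ht.1]
    have h1' : -2 < m := by exact_mod_cast h1
    have h2' : m < 2 := by exact_mod_cast h2
    -- Two points of `[0, 1]` differ by at most `1`, so the number of full turns is `-1`, `0` or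
    -- `1`.
    obtain rfl | rfl | rfl : m = -1 ∨ m = 0 ∨ m = 1 := by omega
    · refine Or.inr (Or.inl ⟨Subtype.ext ?_, Subtype.ext ?_⟩) <;> push_cast at hst ⊢ <;>
        linarith [hs.1, ht.2]
    · exact Or.inl (Subtype.ext (by simpa using hst))
    · refine Or.inr (Or.inr ⟨Subtype.ext ?_, Subtype.ext ?_⟩) <;> push_cast at hst ⊢ <;>
        linarith [hs.2, ht.1]
  · rintro (rfl | ⟨rfl, rfl⟩ | ⟨rfl, rfl⟩) <;> simp

theorem exists_circleExp_two_pi_mul_eq (z : Circle) :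
    ∃ t : unitInterval, Circle.exp (2 * Real.pi * t) = z := by
  have hp := Real.pi_pos
  have h1 := Complex.neg_pi_lt_arg (z : ℂ)
  have h2 := Complex.arg_le_pi (z : ℂ)
  rcases le_total 0 (Complex.arg z) with h | h
  · refine ⟨⟨Complex.arg z / (2 * Real.pi), by positivity, ?_⟩, ?_⟩
    · rw [div_le_one (by positivity)]
      linarith
    · simp only
      rw [mul_div_cancel₀ _ (by positivity), Circle.exp_arg]
  · refine ⟨⟨Complex.arg z / (2 * Real.pi) + 1, ?_, ?_⟩, ?_⟩
    · rw [← sub_le_iff_le_add, le_div_iff₀ (by positivity)]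
      linarith
    · have : Complex.arg z / (2 * Real.pi) ≤ 0 := div_nonpos_of_nonpos_of_nonneg h (by positivity)
      linarith
    · simp only
      rw [mul_add, mul_div_cancel₀ _ (by positivity), mul_one, Circle.exp_add_two_pi,
        Circle.exp_arg]

theorem isMappingTorus_prod_circle {S : Type*} [TopologicalSpace S] [CompactSpace S] [T2Space S] :
    IsMappingTorus (S := S) id
      (fun p : S × unitInterval => (p.1, Circle.exp (2 * Real.pi * p.2))) where
  isQuotientMap := by
    refine isQuotientMap_of_compact ?_ ?_
    · exact continuous_fst.prodMk (Circle.exp.continuous.comp (by fun_prop))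
    · rintro ⟨x, z⟩
      obtain ⟨t, rfl⟩ := exists_circleExp_two_pi_mul_eq z
      exact ⟨(x, t), rfl⟩
  eq_iff := by
    rintro ⟨x, s⟩ ⟨y, t⟩
    simp only [Prod.mk.injEq, circleExp_two_pi_mul_eq_iff, id]
    constructor
    · rintro ⟨rfl, h | h | h⟩
      exacts [Or.inl ⟨rfl, h⟩, Or.inr (Or.inl ⟨h.1, h.2, rfl⟩), Or.inr (Or.inr ⟨h.1, h.2, rfl⟩)]
    · rintro (⟨rfl, h⟩ | ⟨h1, h2, rfl⟩ | ⟨h1, h2, rfl⟩)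
      exacts [⟨rfl, Or.inl h⟩, ⟨rfl, Or.inr (Or.inl ⟨h1, h2⟩)⟩, ⟨rfl, Or.inr (Or.inr ⟨h1, h2⟩)⟩]

/-- The part of a mapping torus over `(0, 1)` is an open cylinder. -/
theorem IsMappingTorus.isOpenEmbedding {S N : Type*} [TopologicalSpace S] [TopologicalSpace N]
    {τ : S → S} {π : S × unitInterval → N} (hπ : IsMappingTorus τ π) :
    Topology.IsOpenEmbedding (fun p : S × Set.Ioo (0 : ℝ) 1 =>
      π (p.1, ⟨p.2, Set.Ioo_subset_Icc_self p.2.2⟩)) := by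
  have hι : Topology.IsOpenEmbedding
      (fun t : Set.Ioo (0 : ℝ) 1 => (⟨t, Set.Ioo_subset_Icc_self t.2⟩ : unitInterval)) := by
    refine .of_continuous_injective_isOpenMap (by fun_prop) ?_ ?_
    · intro s t h
      exact Subtype.ext (congrArg Subtype.val h :)
    · intro U hU
      obtain ⟨V, hV, rfl⟩ := isOpen_induced_iff.1 hU
      refine isOpen_induced_iff.2 ⟨V ∩ Set.Ioo 0 1, hV.inter isOpen_Ioo, ?_⟩
      ext t
      constructor
      · rintro ⟨h1, h2⟩
        exact ⟨⟨t, h2⟩, h1, rfl⟩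
      · rintro ⟨s, hs, rfl⟩
        exact ⟨hs, s.2⟩
  have hprod := (Topology.IsOpenEmbedding.id (X := S)).prodMap hι
  -- Over `(0, 1)` the fibers of `π` are single points, so open sets there are saturated and have
  -- open images.
  have hfib : ∀ (p : S × Set.Ioo (0 : ℝ) 1) q,
      π (p.1, ⟨p.2, Set.Ioo_subset_Icc_self p.2.2⟩) = π q →
      q = (p.1, ⟨p.2, Set.Ioo_subset_Icc_self p.2.2⟩) := by
    intro p q h
    rcases (hπ.eq_iff _ _).1 h with h | ⟨h, -⟩ | ⟨-, h, -⟩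
    · exact h.symm
    · exact absurd (congrArg Subtype.val h) p.2.2.1.ne'
    · exact absurd (congrArg Subtype.val h) p.2.2.2.ne
  refine .of_continuous_injective_isOpenMap ?_ ?_ ?_
  · exact hπ.isQuotientMap.continuous.comp hprod.continuous
  · intro p q h
    exact hprod.injective (hfib p _ h).symm
  · intro U hU
    rw [← hπ.isQuotientMap.isOpen_preimage]
    convert hprod.isOpenMap U hU using 1
    ext q
    constructor
    · rintro ⟨p, hp, h⟩
      exact ⟨p, hp, (hfib p q h).symm⟩
    · rintro ⟨p, hp, rfl⟩
      exact ⟨p, hp, rfl⟩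

end Quotients

/-! ### The realization as a mapping torus -/

section Unrolling

variable {n : ℕ}

/-- Three cylinders over the sphere. -/
abbrev Cylinders (n : ℕ) : Type := (UnitSphere n × unitInterval) × Fin 3

theorem norm_coe_unitSphere (x : UnitSphere n) : ‖(x : EuclideanSpace ℝ (Fin (n + 1)))‖ = 1 :=
  norm_eq_of_mem_sphere x

/-- The map of the three cylinders to the realization of `BM (n + 2)`. -/
noncomputable def cylinderMap (a : Cylinders n) : realization (BM (n + 2)) :=
  ⟨cylinderPoint a.1.1 a.1.2 a.2,
    cylinderPoint_mem (ne_zero_of_norm_eq_one (norm_coe_unitSphere a.1.1)) a.1.2.2 a.2⟩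

theorem continuous_cylinderMap : Continuous (cylinderMap (n := n)) := by
  refine continuous_prod_of_discrete_right.2 fun k => Continuous.subtype_mk ?_ _
  refine continuous_pi fun v => ?_
  have hq : Continuous fun p : UnitSphere n × unitInterval =>
      ((⟨p.1, ne_zero_of_norm_eq_one (norm_coe_unitSphere p.1)⟩ :
        {x : EuclideanSpace ℝ (Fin (n + 1)) // x ≠ 0}), (p.2 : ℝ)) := by
    fun_prop
  exact (continuous_cylinderPoint k v).comp hq

theorem cylinderMap_surjective : Function.Surjective (cylinderMap (n := n)) := by
  rintro ⟨w, hw⟩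
  obtain ⟨x, hx, s, hs, k, h⟩ := exists_cylinderPoint_eq hw
  exact ⟨((⟨x, by simpa using hx⟩, ⟨s, hs⟩), k), Subtype.ext h⟩

instance : CompactSpace (UnitSphere n) := Metric.sphere.compactSpace _ _

theorem isQuotientMap_cylinderMap : Topology.IsQuotientMap (cylinderMap (n := n)) :=
  isQuotientMap_of_compact continuous_cylinderMap cylinderMap_surjective

/-- The end of a cylinder is glued to the beginning of the next one by the antipodal map. -/
def Glued (a b : Cylinders n) : Prop :=
  a.1.2 = 1 ∧ b.1.2 = 0 ∧ b.2 = a.2 + 1 ∧ b.1.1 = -a.1.1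

theorem cylinderMap_eq_of_glued {a b : Cylinders n} (h : Glued a b) :
    cylinderMap a = cylinderMap b := by
  obtain ⟨⟨x, s⟩, k⟩ := a
  obtain ⟨⟨y, t⟩, l⟩ := b
  obtain ⟨h1, h2, h3, h4⟩ := h
  simp only at h1 h2 h3 h4
  subst h1 h2 h3 h4
  refine Subtype.ext ?_
  simpa [cylinderMap] using cylinderPoint_one_eq (x : EuclideanSpace ℝ (Fin (n + 1))) k

theorem glued_of_cylinderMap_eq {a b : Cylinders n} (h : cylinderMap a = cylinderMap b)
    (hk : b.2 = a.2 + 1) : Glued a b := by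
  obtain ⟨⟨x, s⟩, k⟩ := a
  obtain ⟨⟨y, t⟩, l⟩ := b
  simp only at hk
  subst hk
  obtain ⟨h1, h2, h3⟩ := eq_of_cylinderPoint_eq_succ (norm_coe_unitSphere x) (norm_coe_unitSphere y)
    s.2.2 (congrArg Subtype.val h)
  exact ⟨Subtype.ext h2, Subtype.ext h3, rfl, Subtype.ext h1⟩

/-- Among three cyclically ordered cylinders, any two are equal or consecutive in one of the two
orders. -/
theorem cylinderMap_eq_iff {a b : Cylinders n} :
    cylinderMap a = cylinderMap b ↔ a = b ∨ Glued a b ∨ Glued b a := by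
  constructor
  · intro h
    rcases fin_three_cases a.2 b.2 with hk | hk | hk
    · obtain ⟨⟨x, s⟩, k⟩ := a
      obtain ⟨⟨y, t⟩, l⟩ := b
      simp only at hk
      subst hk
      obtain ⟨h1, h2⟩ := eq_of_cylinderPoint_eq_self (norm_coe_unitSphere x)
        (norm_coe_unitSphere y) (congrArg Subtype.val h)
      exact Or.inl (Prod.ext (Prod.ext (Subtype.ext h1.symm) (Subtype.ext h2.symm)) rfl)
    · exact Or.inr (Or.inl (glued_of_cylinderMap_eq h hk))
    · refine Or.inr (Or.inr (glued_of_cylinderMap_eq h.symm ?_))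
      rw [hk, add_assoc]
      exact (add_zero _).symm
  · rintro (rfl | h | h)
    exacts [rfl, cylinderMap_eq_of_glued h, (cylinderMap_eq_of_glued h).symm]

/-- The cyclic symmetry of the realization of `BM (n + 2)`. -/
theorem exists_homeomorph_shift (j : Fin 3) :
    ∃ e : realization (BM (n + 2)) ≃ₜ realization (BM (n + 2)),
      ∀ a : Cylinders n, e (cylinderMap a) = cylinderMap (a.1, a.2 + j) := by
  refine exists_homeomorph_of_isQuotientMap isQuotientMap_cylinderMap
    (g := fun a => cylinderMap (a.1, a.2 + j)) (isQuotientMap_of_compact ?_ ?_) fun a b => ?_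
  · refine continuous_cylinderMap.comp (continuous_fst.prodMk ?_)
    exact (continuous_of_discreteTopology (f := fun k : Fin 3 => k + j)).comp continuous_snd
  · intro w
    obtain ⟨a, rfl⟩ := cylinderMap_surjective w
    exact ⟨(a.1, a.2 - j), by simp⟩
  -- The gluing depends only on the difference of the indices, so a shift preserves the fibers.
  · rw [cylinderMap_eq_iff, cylinderMap_eq_iff]
    simp only [Glued, Prod.ext_iff, add_right_comm _ j, add_left_inj]

/-- The time at which the unrolled path is at time `s` in the `k`-th cylinder. -/
noncomputable def unrollTime (s : unitInterval) (k : Fin 3) : unitInterval :=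
  ⟨((k : ℕ) + (s : ℝ)) / 3, by
    have := s.2.1
    positivity, by
    have h1 := s.2.2
    have h2 : ((k : ℕ) : ℝ) ≤ 2 := by exact_mod_cast Nat.le_of_lt_succ k.2
    rw [div_le_one (by norm_num)]
    linarith⟩

theorem coe_unrollTime (s : unitInterval) (k : Fin 3) :
    (unrollTime s k : ℝ) = ((k : ℕ) + (s : ℝ)) / 3 := rfl

theorem exists_unrollTime_eq (t : unitInterval) : ∃ s k, unrollTime s k = t := by
  have h0 := t.2.1
  have h1 := t.2.2
  by_cases ha : (t : ℝ) ≤ 1 / 3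
  · refine ⟨⟨3 * t, by linarith, by linarith⟩, 0, Subtype.ext ?_⟩
    simp [coe_unrollTime]
  by_cases hb : (t : ℝ) ≤ 2 / 3
  · refine ⟨⟨3 * t - 1, by linarith, by linarith⟩, 1, Subtype.ext ?_⟩
    simp [coe_unrollTime]
  · refine ⟨⟨3 * t - 2, by linarith, by linarith⟩, 2, Subtype.ext ?_⟩
    simp [coe_unrollTime]

/-- The antipodal map, on the middle cylinder only. -/
noncomputable def flipMiddle (k : Fin 3) (x : UnitSphere n) : UnitSphere n := if k = 1 then -x else x

theorem flipMiddle_flipMiddle (k : Fin 3) (x : UnitSphere n) :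
    flipMiddle k (flipMiddle k x) = x := by
  unfold flipMiddle
  split_ifs <;> simp

theorem flipMiddle_injective (k : Fin 3) : Function.Injective (flipMiddle (n := n) k) :=
  Function.LeftInverse.injective (flipMiddle_flipMiddle k)

/-- The three cylinders, placed one after the other and twisted by `R`. -/
noncomputable def unroll (R : unitInterval → UnitSphere n → UnitSphere n) (a : Cylinders n) :
    UnitSphere n × unitInterval :=
  (R (unrollTime a.1.2 a.2) (flipMiddle a.2 a.1.1), unrollTime a.1.2 a.2)

theorem continuous_unroll {R : unitInterval → UnitSphere n → UnitSphere n}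
    (hR : Continuous fun p : UnitSphere n × unitInterval => R p.2 p.1) : Continuous (unroll R) := by
  refine continuous_prod_of_discrete_right.2 fun k => ?_
  have h1 : Continuous fun p : UnitSphere n × unitInterval => unrollTime p.2 k := by
    unfold unrollTime
    fun_prop
  have h2 : Continuous fun p : UnitSphere n × unitInterval => flipMiddle k p.1 := by
    unfold flipMiddle
    split_ifs
    · exact continuous_neg.comp continuous_fst
    · exact continuous_fst
  exact (hR.comp (h2.prodMk h1)).prodMk h1

theorem unroll_surjective {R : unitInterval → UnitSphere n → UnitSphere n}
    (hR : ∀ t, Function.Surjective (R t)) : Function.Surjective (unroll R) := by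
  rintro ⟨y, t⟩
  obtain ⟨s, k, rfl⟩ := exists_unrollTime_eq t
  obtain ⟨x, rfl⟩ := hR (unrollTime s k) y
  exact ⟨((flipMiddle k x, s), k), by simp [unroll, flipMiddle_flipMiddle]⟩

theorem unrollTime_eq_zero_iff {s : unitInterval} {k : Fin 3} :
    unrollTime s k = 0 ↔ s = 0 ∧ k = 0 := by
  have h0 := s.2.1
  rw [Subtype.ext_iff, coe_unrollTime, Subtype.ext_iff]
  fin_cases k <;> simp <;> linarith

theorem unrollTime_eq_one_iff {s : unitInterval} {k : Fin 3} :
    unrollTime s k = 1 ↔ s = 1 ∧ k = 2 := by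
  have h0 := s.2.2
  rw [Subtype.ext_iff, coe_unrollTime, Subtype.ext_iff]
  fin_cases k <;> simp
  · intro h
    linarith
  · intro h
    linarith
  · constructor
    · intro h
      refine Subtype.ext ?_
      push_cast
      linarith
    · rintro rfl
      norm_num

theorem unrollTime_one_eq {k : Fin 3} (hk : k ≠ 2) : unrollTime 1 k = unrollTime 0 (k + 1) := by
  apply Subtype.ext
  fin_cases k
  · simp [coe_unrollTime]
  · simp [coe_unrollTime]
    norm_num
  · simp at hk

/-- The three time intervals meet only at common endpoints. The conditions `k ≠ 2` and `l ≠ 2`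
exclude the wrap-around of `Fin 3`, where the times are `1` and `0`. -/
theorem cases_of_unrollTime_eq {s t : unitInterval} {k l : Fin 3} (h : unrollTime s k = unrollTime t l) :
    (s = t ∧ k = l) ∨ (s = 1 ∧ t = 0 ∧ l = k + 1 ∧ k ≠ 2) ∨ (t = 1 ∧ s = 0 ∧ k = l + 1 ∧ l ≠ 2) := by
  have hs := s.2
  have ht := t.2
  rw [Subtype.ext_iff, coe_unrollTime, coe_unrollTime] at h
  simp only [Subtype.ext_iff, Set.Icc.coe_one, Set.Icc.coe_zero]
  have h' : ((k : ℕ) : ℝ) + s = (l : ℕ) + t := by linarith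
  obtain ⟨hs0, hs1⟩ := hs
  obtain ⟨ht0, ht1⟩ := ht
  fin_cases k <;> fin_cases l <;> simp at h' ⊢ <;>
    first
    | linarith
    | (refine ⟨Subtype.ext ?_, Subtype.ext ?_⟩ <;> push_cast <;> linarith)

/-- The realization of `BM (n + 2)` is the mapping torus of any map that an isotopy connects to the
antipodal map. -/
theorem exists_homeomorph_of_isotopy {N : Type*} [TopologicalSpace N]
    {τ : UnitSphere n → UnitSphere n} {π : UnitSphere n × unitInterval → N}
    (hπ : IsMappingTorus τ π) {R : unitInterval → UnitSphere n → UnitSphere n}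
    (hR : Continuous fun p : UnitSphere n × unitInterval => R p.2 p.1)
    (hbij : ∀ t, Function.Bijective (R t)) (hend : ∀ x, R 1 x = τ (R 0 (-x))) :
    ∃ e : realization (BM (n + 2)) ≃ₜ N, ∀ a, e (cylinderMap a) = π (unroll R a) := by
  have hglue : ∀ a b : Cylinders n, Glued a b → π (unroll R a) = π (unroll R b) := by
    rintro ⟨⟨x, s⟩, k⟩ ⟨⟨y, t⟩, l⟩ ⟨h1, h2, h3, h4⟩
    simp only at h1 h2 h3 h4
    subst h1 h2 h3 h4
    -- The seam from the last cylinder to the first joins time `1` to time `0` and is realized by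
    -- `τ`. At the other two seams `flipMiddle` cancels the antipodal gluing.
    by_cases hk : k = 2
    · subst hk
      refine (hπ.eq_iff _ _).2 (Or.inr (Or.inr ?_))
      have e0 : unrollTime 0 (2 + 1) = 0 := unrollTime_eq_zero_iff.2 ⟨rfl, rfl⟩
      have e1 : unrollTime 1 2 = 1 := unrollTime_eq_one_iff.2 ⟨rfl, rfl⟩
      refine ⟨e0, e1, ?_⟩
      simp only [unroll, e0, e1]
      exact hend x
    · congr 1
      simp only [unroll, unrollTime_one_eq hk]
      congr 2
      fin_cases k
      · simp [flipMiddle]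
      · simp [flipMiddle]
      · simp at hk
  have hinj : ∀ a b : Cylinders n, unroll R a = unroll R b → a = b ∨ Glued a b ∨ Glued b a := by
    rintro ⟨⟨x, s⟩, k⟩ ⟨⟨y, t⟩, l⟩ h
    simp only [unroll, Prod.mk.injEq] at h
    obtain ⟨h1, h2⟩ := h
    rw [h2] at h1
    replace h1 := (hbij _).1 h1
    rcases cases_of_unrollTime_eq h2 with ⟨rfl, rfl⟩ | ⟨rfl, rfl, rfl, hk⟩ | ⟨rfl, rfl, rfl, hk⟩
    · rw [flipMiddle_injective k h1]
      exact Or.inl rfl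
    · refine Or.inr (Or.inl ⟨rfl, rfl, rfl, ?_⟩)
      fin_cases k <;> simp [flipMiddle] at h1 hk ⊢
      · rw [h1, neg_neg]
      · exact h1.symm
    · refine Or.inr (Or.inr ⟨rfl, rfl, rfl, ?_⟩)
      fin_cases l <;> simp [flipMiddle] at h1 hk ⊢
      · rw [← h1, neg_neg]
      · exact h1
  have hends : ∀ a b : Cylinders n, (unroll R a).2 = 0 → (unroll R b).2 = 1 →
      (unroll R b).1 = τ (unroll R a).1 → Glued b a := by
    rintro ⟨⟨x, s⟩, k⟩ ⟨⟨y, t⟩, l⟩ h1 h2 h3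
    obtain ⟨rfl, rfl⟩ := unrollTime_eq_zero_iff.1 h1
    obtain ⟨rfl, rfl⟩ := unrollTime_eq_one_iff.1 h2
    simp only [unroll] at h1 h2 h3
    rw [h1, h2] at h3
    have h4 := hend (-x)
    rw [neg_neg] at h4
    have h5 := (hbij 1).1 (h3.trans h4.symm)
    refine ⟨rfl, rfl, rfl, ?_⟩
    simp only
    rw [show y = -x from h5, neg_neg]
  refine exists_homeomorph_of_isQuotientMap isQuotientMap_cylinderMap (g := π ∘ unroll R)
    (hπ.isQuotientMap.comp (isQuotientMap_of_compact (continuous_unroll hR)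
      (unroll_surjective fun t => (hbij t).2))) fun a b => ?_
  rw [cylinderMap_eq_iff]
  constructor
  · rintro (rfl | h | h)
    exacts [rfl, hglue a b h, (hglue b a h).symm]
  · intro h
    rcases (hπ.eq_iff _ _).1 h with h | ⟨h1, h2, h3⟩ | ⟨h1, h2, h3⟩
    · exact hinj a b h
    · exact Or.inr (Or.inr (hends a b h1 h2 h3))
    · exact Or.inr (Or.inl (hends b a h1 h2 h3))

end Unrolling

/-! ### Local charts -/

section Charts

variable {n : ℕ}

theorem exists_chart_of_isOpenEmbedding {N : Type*} [TopologicalSpace N]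
    {j : UnitSphere n × Set.Ioo (0 : ℝ) 1 → N} (hj : Topology.IsOpenEmbedding j)
    (p : UnitSphere n × Set.Ioo (0 : ℝ) 1) :
    ∃ e : OpenPartialHomeomorph N (EuclideanSpace ℝ (Fin (n + 1))), j p ∈ e.source := by
  have : Nonempty (UnitSphere n × Set.Ioo (0 : ℝ) 1) := ⟨p⟩
  have : Nonempty (Set.Ioo (0 : ℝ) 1) := ⟨p.2⟩
  have hv : Topology.IsOpenEmbedding (Subtype.val : Set.Ioo (0 : ℝ) 1 → ℝ) :=
    isOpen_Ioo.isOpenEmbedding_subtypeVal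
  let L : (EuclideanSpace ℝ (Fin n) × ℝ) ≃L[ℝ] EuclideanSpace ℝ (Fin (n + 1)) :=
    ContinuousLinearEquiv.ofFinrankEq (by simp)
  have : Fact (Module.finrank ℝ (EuclideanSpace ℝ (Fin (n + 1))) = n + 1) := ⟨by simp⟩
  refine ⟨(hj.toOpenPartialHomeomorph j).symm.trans
    (((chartAt (EuclideanSpace ℝ (Fin n)) p.1).prod (hv.toOpenPartialHomeomorph _)).trans
      L.toHomeomorph.toOpenPartialHomeomorph), ?_⟩
  simp [hj.toOpenPartialHomeomorph_left_inv]

/-- The constant isotopy presents the realization as the mapping torus of the antipodal map. A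
cyclic shift by `1 - k` moves the point to the middle cylinder, whose times lie in `[1/3, 2/3]`,
away from the seam. -/
theorem exists_chart (w : realization (BM (n + 2))) :
    ∃ e : OpenPartialHomeomorph (realization (BM (n + 2))) (EuclideanSpace ℝ (Fin (n + 1))),
      w ∈ e.source := by
  have hT : IsMappingTorus (fun x : UnitSphere n => -x)
      (Quot.mk fun p q : UnitSphere n × unitInterval => p.2 = 0 ∧ q.2 = 1 ∧ q.1 = -p.1) :=
    isMappingTorus_quot neg_injective fun _ _ => Iff.rfl
  obtain ⟨E, hE⟩ := exists_homeomorph_of_isotopy hT (R := fun _ => id) continuous_fst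
    (fun _ => Function.bijective_id) (fun x => (neg_neg x).symm)
  obtain ⟨⟨⟨x, s⟩, k⟩, rfl⟩ := cylinderMap_surjective w
  obtain ⟨ρ, hρ⟩ := exists_homeomorph_shift (n := n) (1 - k)
  have hs := s.2
  have ht : (unrollTime s 1 : ℝ) ∈ Set.Ioo (0 : ℝ) 1 := by
    rw [coe_unrollTime]
    constructor <;> simp <;> linarith [hs.1, hs.2]
  obtain ⟨e, he⟩ := exists_chart_of_isOpenEmbedding hT.isOpenEmbedding
    (flipMiddle 1 x, ⟨unrollTime s 1, ht⟩)
  refine ⟨(ρ.trans E).toOpenPartialHomeomorph.trans e, ?_⟩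
  simp only [OpenPartialHomeomorph.trans_source, Homeomorph.toOpenPartialHomeomorph_source,
    Set.univ_inter, Set.mem_preimage, Homeomorph.toOpenPartialHomeomorph_apply,
    Homeomorph.trans_apply, hρ, hE]
  convert he using 2
  simp [unroll]

theorem isSimplicialManifold_BM : IsSimplicialManifold (n + 1) (BM (n + 2)) where
  t2 := inferInstance
  secondCountable := inferInstance
  locallyEuclidean := by
    choose e he using exists_chart (n := n)
    exact ⟨⟨Set.range e, e, he, fun x => ⟨x, rfl⟩⟩⟩

end Charts

/-! ### Simultaneous rotations of pairs of coordinates -/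

section Rotations

variable {m : ℕ}

/-- The linear map that acts on the coordinates `i` and `p i` by the matrix with entries `c` and
`± s`. -/
noncomputable def pairMap (p : Fin m → Fin m) (c s : Fin m → ℝ) (x : EuclideanSpace ℝ (Fin m)) :
    EuclideanSpace ℝ (Fin m) :=
  WithLp.toLp 2 fun i => c i * x i + s i * x (p i)

/-- Reindexing by the involution `p` preserves `c` and negates `s`, so the mixed terms cancel and
the squares add up by `c ^ 2 + s ^ 2 = 1`. -/
theorem norm_pairMap {p : Fin m → Fin m} (hp : Function.Involutive p) {c s : Fin m → ℝ}
    (hc : ∀ i, c (p i) = c i) (hs : ∀ i, s (p i) = -s i) (hcs : ∀ i, c i ^ 2 + s i ^ 2 = 1)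
    (x : EuclideanSpace ℝ (Fin m)) : ‖pairMap p c s x‖ = ‖x‖ := by
  rw [EuclideanSpace.norm_eq, EuclideanSpace.norm_eq]
  congr 1
  simp only [pairMap, Real.norm_eq_abs, sq_abs]
  have hreindex : ∀ f : Fin m → ℝ, ∑ i, f (p i) = ∑ i, f i := fun f =>
    Equiv.sum_comp hp.toPerm f
  have h1 : ∑ i, s i ^ 2 * x (p i) ^ 2 = ∑ i, s i ^ 2 * x i ^ 2 := by
    rw [← hreindex]
    refine Finset.sum_congr rfl fun i _ => ?_
    rw [hp i, hs, neg_sq]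
  have h2 : ∑ i, c i * s i * x i * x (p i) = 0 := by
    have h := hreindex fun i => c i * s i * x i * x (p i)
    have h' : ∑ i, c (p i) * s (p i) * x (p i) * x (p (p i)) =
        -∑ i, c i * s i * x i * x (p i) := by
      rw [← Finset.sum_neg_distrib]
      refine Finset.sum_congr rfl fun i _ => ?_
      rw [hp i, hs, hc]
      ring
    linarith
  calc ∑ i, (c i * x i + s i * x (p i)) ^ 2
      = ∑ i, c i ^ 2 * x i ^ 2 + ∑ i, s i ^ 2 * x (p i) ^ 2 +
          2 * ∑ i, c i * s i * x i * x (p i) := by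
        rw [Finset.mul_sum, ← Finset.sum_add_distrib, ← Finset.sum_add_distrib]
        exact Finset.sum_congr rfl fun i _ => by ring
    _ = ∑ i, x i ^ 2 := by
        rw [h1, h2, mul_zero, add_zero, ← Finset.sum_add_distrib]
        refine Finset.sum_congr rfl fun i _ => ?_
        rw [← add_mul, hcs, one_mul]

theorem pairMap_neg_pairMap {p : Fin m → Fin m} (hp : Function.Involutive p) {c s : Fin m → ℝ}
    (hc : ∀ i, c (p i) = c i) (hs : ∀ i, s (p i) = -s i) (hcs : ∀ i, c i ^ 2 + s i ^ 2 = 1)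
    (x : EuclideanSpace ℝ (Fin m)) : pairMap p c (-s) (pairMap p c s x) = x := by
  refine PiLp.ext fun i => ?_
  simp only [pairMap, Pi.neg_apply, hp i, hc, hs]
  linear_combination x i * hcs i

/-- The rotation by the angle `θ` in the coordinates `i`, `p i` with `σ i ≠ 0`. -/
noncomputable def pairRotation (p : Fin m → Fin m) (σ : Fin m → ℝ) (θ : ℝ) :
    EuclideanSpace ℝ (Fin m) → EuclideanSpace ℝ (Fin m) :=
  pairMap p (fun i => if σ i = 0 then 1 else Real.cos θ) (fun i => σ i * Real.sin θ)

/-- The orientations `σ i` of the pairs `{i, p i}` of coordinates are `± 1`, or `0` for coordinates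
that are not rotated. -/
structure IsPairing (p : Fin m → Fin m) (σ : Fin m → ℝ) : Prop where
  involutive : Function.Involutive p
  anti : ∀ i, σ (p i) = -σ i
  sq : ∀ i, σ i = 0 ∨ σ i ^ 2 = 1

variable {p : Fin m → Fin m} {σ : Fin m → ℝ}

theorem IsPairing.cos_comp (h : IsPairing p σ) (θ : ℝ) (i : Fin m) :
    (if σ (p i) = 0 then 1 else Real.cos θ) = if σ i = 0 then 1 else Real.cos θ := by
  simp [h.anti]

theorem IsPairing.sin_comp (h : IsPairing p σ) (θ : ℝ) (i : Fin m) :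
    σ (p i) * Real.sin θ = -(σ i * Real.sin θ) := by
  rw [h.anti, neg_mul]

theorem IsPairing.cos_sq_add_sin_sq (h : IsPairing p σ) (θ : ℝ) (i : Fin m) :
    (if σ i = 0 then 1 else Real.cos θ) ^ 2 + (σ i * Real.sin θ) ^ 2 = 1 := by
  rcases h.sq i with hi | hi
  · simp [hi]
  · have h0 : σ i ≠ 0 := by
      intro h0
      simp [h0] at hi
    rw [if_neg h0, mul_pow, hi, one_mul, Real.cos_sq_add_sin_sq]

theorem IsPairing.norm_pairRotation (h : IsPairing p σ) (θ : ℝ) (x : EuclideanSpace ℝ (Fin m)) :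
    ‖pairRotation p σ θ x‖ = ‖x‖ :=
  norm_pairMap h.involutive (h.cos_comp θ) (h.sin_comp θ) (h.cos_sq_add_sin_sq θ) x

theorem IsPairing.pairRotation_neg (h : IsPairing p σ) (θ : ℝ) (x : EuclideanSpace ℝ (Fin m)) :
    pairRotation p σ (-θ) (pairRotation p σ θ x) = x := by
  have e : pairRotation p σ (-θ) = pairMap p (fun i => if σ i = 0 then 1 else Real.cos θ)
      (-fun i => σ i * Real.sin θ) := by
    simp only [pairRotation, Real.cos_neg, Real.sin_neg, mul_neg]
    rfl
  rw [e]
  exact pairMap_neg_pairMap h.involutive (h.cos_comp θ) (h.sin_comp θ) (h.cos_sq_add_sin_sq θ) x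

theorem continuous_pairRotation : Continuous fun q : EuclideanSpace ℝ (Fin m) × ℝ =>
    pairRotation p σ q.2 q.1 := by
  unfold pairRotation pairMap
  refine (PiLp.continuous_toLp 2 _).comp (continuous_pi fun i => ?_)
  dsimp only
  split_ifs <;> fun_prop

theorem pairRotation_zero (x : EuclideanSpace ℝ (Fin m)) : pairRotation p σ 0 x = x := by
  refine PiLp.ext fun i => ?_
  simp [pairRotation, pairMap]

theorem pairRotation_pi_apply (x : EuclideanSpace ℝ (Fin m)) (i : Fin m) :
    pairRotation p σ Real.pi x i = if σ i = 0 then x i else -x i := by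
  simp only [pairRotation, pairMap, Real.sin_pi, Real.cos_pi]
  split_ifs <;> simp

theorem exists_isPairing (k : ℕ) :
    ∃ (p : Fin (k + k) → Fin (k + k)) (σ : Fin (k + k) → ℝ), IsPairing p σ ∧ ∀ i, σ i ≠ 0 := by
  let e : Fin k ⊕ Fin k ≃ Fin (k + k) := finSumFinEquiv
  let f : Fin k ⊕ Fin k → ℝ := Sum.elim (fun _ => 1) (fun _ => -1)
  -- The `i`-th coordinate of the first half is paired with the `i`-th of the second half, with
  -- opposite orientations.
  refine ⟨fun i => e (e.symm i).swap, fun i => f (e.symm i), ⟨fun i => by simp, fun i => ?_,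
    fun i => Or.inr ?_⟩, fun i => ?_⟩
  · rw [e.symm_apply_apply]
    rcases e.symm i with j | j <;> simp [f]
  · rcases e.symm i with j | j <;> simp [f]
  · change f (e.symm i) ≠ 0
    rcases e.symm i with j | j <;> simp [f]

theorem exists_isPairing_succ (k : ℕ) :
    ∃ (p : Fin (k + k + 1) → Fin (k + k + 1)) (σ : Fin (k + k + 1) → ℝ),
      IsPairing p σ ∧ ∀ i, σ i = 0 ↔ i = 0 := by
  obtain ⟨p, σ, h, h0⟩ := exists_isPairing k
  refine ⟨Fin.cases 0 fun i => (p i).succ, Fin.cases 0 σ, ⟨fun i => ?_, fun i => ?_, fun i => ?_⟩,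
    fun i => ?_⟩
  · refine Fin.cases rfl (fun i => ?_) i
    simp [h.involutive i]
  · refine Fin.cases ?_ (fun i => ?_) i
    · simp
    · simp [h.anti i]
  · refine Fin.cases (Or.inl rfl) (fun i => ?_) i
    simpa using h.sq i
  · refine Fin.cases ?_ (fun i => ?_) i
    · simp
    · simpa using h0 i

end Rotations

/-! ### The two homeomorphism types -/

section HomeomorphismType

variable {n : ℕ}

/-- A pairing of the coordinates connects its half-turn to the identity, so that the realization of
`BM (n + 2)` is the mapping torus of the composition of the half-turn and the antipodal map. -/
theorem exists_homeomorph_of_isPairing {N : Type*} [TopologicalSpace N]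
    {τ : UnitSphere n → UnitSphere n} {π : UnitSphere n × unitInterval → N}
    (hπ : IsMappingTorus τ π) {p : Fin (n + 1) → Fin (n + 1)} {σ : Fin (n + 1) → ℝ}
    (h : IsPairing p σ)
    (hτ : ∀ (x : UnitSphere n) i, (τ (-x)).1 i = if σ i = 0 then x.1 i else -x.1 i) :
    Nonempty (realization (BM (n + 2)) ≃ₜ N) := by
  let A : ℝ → UnitSphere n → UnitSphere n := fun θ x =>
    ⟨pairRotation p σ θ x, by
      rw [mem_sphere_zero_iff_norm, h.norm_pairRotation, norm_coe_unitSphere]⟩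
  have hA : ∀ θ, Function.LeftInverse (A (-θ)) (A θ) := fun θ x =>
    Subtype.ext (h.pairRotation_neg θ x)
  have hcont : Continuous fun q : UnitSphere n × unitInterval => A (Real.pi * (q.2 : ℝ)) q.1 := by
    have hq : Continuous fun q : UnitSphere n × unitInterval =>
        ((q.1 : EuclideanSpace ℝ (Fin (n + 1))), Real.pi * (q.2 : ℝ)) := by
      fun_prop
    exact (continuous_pairRotation.comp hq).subtype_mk _
  have hsurj : ∀ θ, Function.Surjective (A θ) := fun θ => by
    have := (hA (-θ)).surjective
    rwa [neg_neg] at this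
  -- The rotation is the identity at time `0` and the half-turn at time `1`, so the required end
  -- condition is exactly `hτ`.
  have hend : ∀ x, A (Real.pi * ((1 : unitInterval) : ℝ)) x =
      τ (A (Real.pi * ((0 : unitInterval) : ℝ)) (-x)) := fun x => by
    have h0 : A (Real.pi * ((0 : unitInterval) : ℝ)) (-x) = -x := by
      refine Subtype.ext ?_
      simp only [A, Set.Icc.coe_zero, mul_zero]
      exact pairRotation_zero _
    rw [h0]
    refine Subtype.ext (PiLp.ext fun i => ?_)
    rw [hτ]
    simp only [A, Set.Icc.coe_one, mul_one]
    exact pairRotation_pi_apply _ i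
  obtain ⟨e, -⟩ := exists_homeomorph_of_isotopy hπ
    (R := fun t => A (Real.pi * (t : ℝ))) hcont (fun t => ⟨(hA _).injective, hsurj _⟩) hend
  exact ⟨e⟩

/-- With `n + 1` even, all coordinates are paired and the half-turn is the antipodal map itself, so
`τ` is the identity. -/
theorem nonempty_homeomorph_prod_circle (hn : Odd n) :
    Nonempty (realization (BM (n + 2)) ≃ₜ UnitSphere n × Circle) := by
  obtain ⟨k, hk⟩ : Even (n + 1) := hn.add_one
  have hpair : ∃ (p : Fin (n + 1) → Fin (n + 1)) (σ : Fin (n + 1) → ℝ),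
      IsPairing p σ ∧ ∀ i, σ i ≠ 0 := by
    rw [hk]
    exact exists_isPairing k
  obtain ⟨p, σ, h, h0⟩ := hpair
  refine exists_homeomorph_of_isPairing isMappingTorus_prod_circle h fun x i => ?_
  rw [if_neg (h0 i)]
  rfl

/-- The reflection in the first coordinate. -/
noncomputable def reflectFirst (x : UnitSphere n) : UnitSphere n :=
  ⟨WithLp.toLp 2 fun i => if i = 0 then -x.1 i else x.1 i, by
    have hx := norm_coe_unitSphere x
    rw [mem_sphere_zero_iff_norm]
    refine Eq.trans ?_ hx
    rw [EuclideanSpace.norm_eq, EuclideanSpace.norm_eq]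
    congr 1
    refine Finset.sum_congr rfl fun i _ => ?_
    dsimp only
    split_ifs <;> simp⟩

theorem reflectFirst_apply (x : UnitSphere n) (i : Fin (n + 1)) :
    (reflectFirst x).1 i = if i = 0 then -x.1 i else x.1 i := rfl

theorem reflectFirst_injective : Function.Injective (reflectFirst (n := n)) := by
  intro x y h
  refine Subtype.ext (PiLp.ext fun i => ?_)
  have hi : (reflectFirst x).1 i = (reflectFirst y).1 i := by rw [h]
  rw [reflectFirst_apply, reflectFirst_apply] at hi
  split_ifs at hi
  · exact neg_injective hi
  · exact hi

/-- With `n + 1` odd, the first coordinate stays fixed. The half-turn negates all the others, which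
is the antipodal map followed by the reflection in the first coordinate. -/
theorem nonempty_homeomorph_nonorientableSphereBundle (hn : Even n) :
    Nonempty (realization (BM (n + 2)) ≃ₜ NonorientableSphereBundle n) := by
  obtain ⟨k, rfl⟩ := hn
  obtain ⟨p, σ, h, h0⟩ := exists_isPairing_succ k
  refine exists_homeomorph_of_isPairing
    (isMappingTorus_quot (τ := reflectFirst) reflectFirst_injective fun p q => ?_) h fun x i => ?_
  · refine and_congr_right fun _ => and_congr_right fun _ => ⟨fun h => ?_, fun h i => ?_⟩
    · exact Subtype.ext (PiLp.ext h)
    · rw [h, reflectFirst_apply]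
  · rw [reflectFirst_apply]
    simp only [h0]
    split_ifs <;> simp

end HomeomorphismType

end BalancedManifold

theorem theorem6p3 (d : ℕ) (hd : 2 ≤ d) :
    -- `BM d` is built by two balanced connected sums and one balanced handle addition
    IsBalancedConnectedSum d (crossPolytope d) (color₁ d) (crossPolytope d) (color₁ d)
        (facetY d) (glueY d) ∧
      IsBalancedConnectedSum d (sum₂ d) (color₂ d) (crossPolytope d) (color₁ d)
        (facetZ d) (glueZ d) ∧
      IsBalancedHandleAddition d (sum₃ d) (color₃ d) (facetX d) (glueX d) ∧
    -- it is a balanced simplicial manifold of dimension `d - 1` with `3 d` vertices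
      IsBalanced d (BM d) (color₃ d) ∧
      IsSimplicialManifold (d - 1) (BM d) ∧
      (vertices (BM d)).ncard = 3 * d ∧
    -- its homeomorphism type
      (Odd d → Nonempty (realization (BM d) ≃ₜ UnitSphere (d - 2) × Circle)) ∧
      (Even d → Nonempty (realization (BM d) ≃ₜ NonorientableSphereBundle (d - 2))) := by
  refine ⟨isBalancedConnectedSum_crossPolytope hd, isBalancedConnectedSum_sum₂ hd,
    isBalancedHandleAddition_sum₃ hd, isBalanced_BM hd, ?_, ncard_vertices_BM hd, ?_, ?_⟩ <;>
    obtain ⟨n, rfl⟩ := Nat.exists_eq_add_of_le' hd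
  · exact isSimplicialManifold_BM
  · exact fun h => nonempty_homeomorph_prod_circle ((Nat.odd_add.1 h).2 even_two)
  · exact fun h => nonempty_homeomorph_nonorientableSphereBundle ((Nat.even_add.1 h).2 even_two)
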